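/- For $j\in\mathbb Z$ let $S_j=\{a+ib : a\in\mathbb R,\ j\le b\le j+1\}\subset\mathbb C$, and for $x,t\in[0,1]$, $\mu\in(0,1]$ let $S_j^{x,t,\mu}=\mu e^{t\pi i}(S_j+ix)$. Let $\mathrm{proj}^\perp_t$ be the orthogonal projection of $\mathbb C$ onto the line $\{re^{(t+\frac12)\pi i}: r\in\mathbb R\}$, and for $A\subseteq\mathbb C$ let $\|A\|_t$ be the Euclidean diameter of $\mathrm{proj}^\perp_t(A)$. Let $X$ be a locally connected continuum (a nonempty, compact, connected, locally connected metrizable space). A generalized path is a continuous function $\gamma:X\to\mathbb C$. For a generalized path $\gamma$ let $C_0,C_1,C_2,\dots$ enumerate, without repetition, all connected components $C$ of the sets $\gamma^{-1}(S_j^{x,t,\mu})$ ($j\in\mathbb Z$) for which $\mathrm{proj}^\perp_t(\gamma(C))$ has more than one point, ordered so that $\|\gamma(C_n)\|_t\ge\|\gamma(C_{n+1})\|_t$ for all $n$ (if there are only finitely many, the remaining terms are taken to be $0$), and put \[ L^{x,t,\mu}(\gamma)=\sum_{n=0}^\infty\frac{\|\gamma(C_n)\|_t}{2^n},\qquad \mathrm{len}(\gamma)=\int_0^1\!\int_0^1\!\int_0^1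 L^{x,t,\mu}(\gamma)\,dx\,dt\,d\mu . \] Suppose $(\gamma_m)_{m\ge 0}$ is a sequence of generalized paths $X\to\mathbb C$ converging uniformly on $X$ to $\gamma:X\to\mathbb C$. Then $\mathrm{len}(\gamma)$ and all $\mathrm{len}(\gamma_m)$ are well defined (for each of these functions an enumeration as above exists for all $x,t\in[0,1]$, $\mu\in(0,1]$, and $L^{x,t,\mu}$ is Lebesgue integrable in $(x,t,\mu)$ over $[0,1]\times[0,1]\times(0,1]$), and \[ \mathrm{len}(\gamma_m)\to\mathrm{len}(\gamma)\qquad\text{as } m\to\infty . \] -/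

import Mathlib

open Set Filter Topology MeasureTheory
open scoped Real

noncomputable section

namespace StripLength

/-- The closed horizontal strip `S_j = {a + ib : a ∈ ℝ, b ∈ [j, j + 1]}` in the plane. -/
def baseStrip (j : ℤ) : Set ℂ :=
  {z | z.im ∈ Icc (j : ℝ) (j + 1)}

/-- The strip `S_j^{x,t,μ} = μ e^{tπi} (S_j + ix)`. -/
def strip (x t μ : ℝ) (j : ℤ) : Set ℂ :=
  (fun z : ℂ => (μ : ℂ) * Complex.exp (t * π * Complex.I) * (z + Complex.I * x)) '' baseStrip j

/-- The line `{r e^{(t + 1/2)πi} : r ∈ ℝ}`, as a real subspace of the plane. -/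
def normalLine (t : ℝ) : Submodule ℝ ℂ :=
  Submodule.span ℝ {Complex.exp ((t + 1 / 2) * π * Complex.I)}

/-- The orthogonal projection of the plane onto the line `{r e^{(t + 1/2)πi} : r ∈ ℝ}`. -/
def projPerp (t : ℝ) (z : ℂ) : ℂ :=
  (normalLine t).starProjection z

/-- `‖A‖_t`, the Euclidean diameter of the projection of `A`. -/
def width (t : ℝ) (A : Set ℂ) : ℝ :=
  Metric.diam (projPerp t '' A)

variable {X : Type*} [TopologicalSpace X]

/-- The connected components of a subset `A` of `X`. -/
def componentsOf (A : Set X) : Set (Set X) :=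
  {C | ∃ p ∈ A, C = connectedComponentIn A p}

/-- The collection of all components of the sets `γ⁻¹(S_j^{x,t,μ})`, `j ∈ ℤ`, whose image under
`γ` has a non-degenerate (more than one-point) projection. -/
def stripComponents (γ : X → ℂ) (x t μ : ℝ) : Set (Set X) :=
  {C | (∃ j : ℤ, C ∈ componentsOf (γ ⁻¹' strip x t μ j)) ∧
    (projPerp t '' (γ '' C)).Nontrivial}

/-- `C_0, C_1, C_2, …` enumerates `stripComponents γ x t μ` without repetition and in the order of
non-increasing `‖γ(C_n)‖_t`. If there are only finitely many components, the list is continued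
by empty sets, which contribute `0`. -/
structure IsOrderedEnumeration (γ : X → ℂ) (x t μ : ℝ) (C : ℕ → Set X) : Prop where
  mem_or_empty : ∀ n, C n ∈ stripComponents γ x t μ ∨ C n = ∅
  exhausts : ∀ D ∈ stripComponents γ x t μ, ∃ n, C n = D
  no_repetition : ∀ m n, C m ∈ stripComponents γ x t μ → C m = C n → m = n
  ordered : ∀ n, width t (γ '' C (n + 1)) ≤ width t (γ '' C n)

theorem width_empty (t : ℝ) : width t ∅ = 0 := by
  simp [width]

theorem IsOrderedEnumeration.width_le {γ : X → ℂ} {x t μ : ℝ} {C D : ℕ → Set X}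
    (hC : IsOrderedEnumeration γ x t μ C) (hD : IsOrderedEnumeration γ x t μ D) (n : ℕ) :
    width t (γ '' C n) ≤ width t (γ '' D n) := by
  have aC : Antitone fun k => width t (γ '' C k) := antitone_nat_of_succ_le hC.ordered
  have aD : Antitone fun k => width t (γ '' D k) := antitone_nat_of_succ_le hD.ordered
  by_cases hpos : 0 < width t (γ '' C n)
  · have hmem : ∀ k, k ≤ n → C k ∈ stripComponents γ x t μ := by
      intro k hk
      rcases hC.mem_or_empty k with h | h
      · exact h
      · have h1 : width t (γ '' C n) ≤ width t (γ '' C k) := aC hk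
        rw [h, image_empty, width_empty] at h1
        exact absurd hpos (not_lt.mpr h1)
    have hex : ∀ k, ∃ l, k ≤ n → D l = C k := by
      intro k
      by_cases hk : k ≤ n
      · obtain ⟨l, hl⟩ := hD.exhausts _ (hmem k hk)
        exact ⟨l, fun _ => hl⟩
      · exact ⟨0, fun h => absurd h hk⟩
    choose s hs using hex
    have hk : ∃ k, k ≤ n ∧ n ≤ s k := by
      by_contra hcon
      push Not at hcon
      obtain ⟨a, ha, b, hb, hab, he⟩ := Finset.exists_ne_map_eq_of_card_lt_of_maps_to
        (s := Finset.range (n + 1)) (t := Finset.range n) (f := s) (by simp)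
        (by
          intro k hk
          have := hcon k (by simpa [Nat.lt_succ_iff] using hk)
          simpa using this)
      have ha' : a ≤ n := by simpa [Nat.lt_succ_iff] using ha
      have hb' : b ≤ n := by simpa [Nat.lt_succ_iff] using hb
      refine hab (hC.no_repetition a b (hmem a ha') ?_)
      rw [← hs a ha', ← hs b hb', he]
    obtain ⟨k, hkn, hnk⟩ := hk
    calc width t (γ '' C n) ≤ width t (γ '' C k) := aC hkn
      _ = width t (γ '' D (s k)) := by rw [hs k hkn]
      _ ≤ width t (γ '' D n) := aD hnk
  · exact (not_lt.mp hpos).trans Metric.diam_nonneg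

/-- The sequence of widths, hence the sum below, does not depend on the ordered enumeration. -/
theorem IsOrderedEnumeration.width_eq {γ : X → ℂ} {x t μ : ℝ} {C D : ℕ → Set X}
    (hC : IsOrderedEnumeration γ x t μ C) (hD : IsOrderedEnumeration γ x t μ D) (n : ℕ) :
    width t (γ '' C n) = width t (γ '' D n) :=
  le_antisymm (hC.width_le hD n) (hD.width_le hC n)

open Classical in
/-- `L^{x,t,μ}(γ) = ∑_{n ≥ 0} ‖γ(C_n)‖_t / 2^n`, where `C_0, C_1, …` is any ordered enumeration
(the value is the same for all of them). -/
def stripSum (γ : X → ℂ) (x t μ : ℝ) : ℝ :=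
  if h : ∃ C : ℕ → Set X, IsOrderedEnumeration γ x t μ C then
    ∑' n : ℕ, width t (γ '' h.choose n) / 2 ^ n
  else 0

/-- `len(γ)`, the integral of `L^{x,t,μ}(γ)` over `x, t, μ` (innermost to outermost). -/
def len (γ : X → ℂ) : ℝ :=
  ∫ μ in (0 : ℝ)..1, ∫ t in (0 : ℝ)..1, ∫ x in (0 : ℝ)..1, stripSum γ x t μ

/-- The integral that defines `len γ` makes sense: for all parameters an ordered enumeration exists,
and `L^{x,t,μ}(γ)` is Lebesgue integrable in `(x, t, μ)`. -/
def LenWellDefined (γ : X → ℂ) : Prop :=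
  (∀ x ∈ Icc (0 : ℝ) 1, ∀ t ∈ Icc (0 : ℝ) 1, ∀ μ ∈ Ioc (0 : ℝ) 1,
    ∃ C : ℕ → Set X, IsOrderedEnumeration γ x t μ C) ∧
  IntegrableOn (fun p : ℝ × ℝ × ℝ => stripSum γ p.1 p.2.1 p.2.2)
    (Icc (0 : ℝ) 1 ×ˢ Icc (0 : ℝ) 1 ×ˢ Ioc (0 : ℝ) 1)

end StripLength

end

/-! Composing a path with the signed height across the strips and rescaling turns strips into unit
bands `[j, j + 1]` of a real function `f : C(X, ℝ)`, which depends continuously on the path. Fix a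
dense sequence `u`. By local connectedness, every component of a band whose image is nondegenerate
contains some `u n`, so countably many indices `(n, j)` name all relevant components. Since
decreasing order maximizes a sum with weights `2⁻ⁿ`, the ordered sum equals a supremum over finite
lists of distinct components, namely `μ * bandSum u f` (`IsOrderedEnumeration.tsum_eq`). This form
needs no ordering and gives measurability.

The supremum is not continuous everywhere: a component can break apart when it is held together only
through the boundary of its band. It is continuous at regular `f`, where dense points joined in a
closed band are already joined in a smaller one (`IsRegular.continuousAt_bandSum`). Components never
grow abruptly under perturbation, because in a compact Hausdorff space they are intersections of
clopen sets; regularity keeps them from breaking. Compactness and local connectedness reduce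
components of width at least `ε` to finitely many indices, uniformly near `f`, and the rest
contribute at most `2 * ε`.

Regularity holds for almost all parameters. Bands with a fixed center are nested as `μ` grows, so
two given dense points become joined at one critical `μ` at most, and Fubini applies
(`ae_isRegular`). Dominated convergence concludes. -/

namespace StripLength

noncomputable section

/-! ### Components of bands under perturbation of the function -/

section Components

variable {X : Type*} [TopologicalSpace X]

/-- If the component of `p` in `f ⁻¹' I` lies in an open set, so does that of any nearby function. -/
theorem eventually_connectedComponentIn_preimage_subset [CompactSpace X] [T2Space X]
    (f : C(X, ℝ)) (p : X) {I : Set ℝ} (hI : IsClosed I) {O : Set X} (hO : IsOpen O)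
    (h : connectedComponentIn (f ⁻¹' I) p ⊆ O) :
    ∀ᶠ g : C(X, ℝ) in 𝓝 f, connectedComponentIn (g ⁻¹' I) p ⊆ O := by
  by_cases hp : p ∈ f ⁻¹' I
  · have hKc : IsClosed (f ⁻¹' I) := hI.preimage f.continuous
    have hK : IsCompact (f ⁻¹' I) := hKc.isCompact
    have : CompactSpace (f ⁻¹' I) := isCompact_iff_compactSpace.mp hK
    let p' : (f ⁻¹' I) := ⟨p, hp⟩
    -- In a compact Hausdorff space the component is the intersection of its clopen neighborhoods,
    -- so by compactness one of these already lies in `O`.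
    have hex : ∃ A : Set (f ⁻¹' I), IsClopen A ∧ p' ∈ A ∧ A ⊆ ((↑) : (f ⁻¹' I) → X) ⁻¹' O := by
      have : Nonempty { s : Set (f ⁻¹' I) // IsClopen s ∧ p' ∈ s } :=
        ⟨⟨univ, isClopen_univ, mem_univ _⟩⟩
      have hdir : Directed (· ⊇ ·)
          (fun s : { s : Set (f ⁻¹' I) // IsClopen s ∧ p' ∈ s } => s.1) := by
        rintro ⟨a, ha, pa⟩ ⟨b, hb, pb⟩
        exact ⟨⟨a ∩ b, ha.inter hb, pa, pb⟩, inter_subset_left, inter_subset_right⟩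
      obtain ⟨⟨A, hA, pA⟩, hAO⟩ := exists_subset_nhds_of_compactSpace hdir
        (fun s => s.2.1.1) (U := ((↑) : (f ⁻¹' I) → X) ⁻¹' O) (by
          intro y hy
          refine (hO.preimage continuous_subtype_val).mem_nhds ?_
          rw [← connectedComponent_eq_iInter_isClopen] at hy
          refine h ?_
          rw [connectedComponentIn_eq_image hp]
          exact mem_image_of_mem _ hy)
      exact ⟨A, hA, pA, hAO⟩
    obtain ⟨A, hA, pA, hAO⟩ := hex
    have hAc : IsCompact (((↑) : (f ⁻¹' I) → X) '' A) :=
      hA.1.isCompact.image continuous_subtype_val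
    have hBc : IsCompact (((↑) : (f ⁻¹' I) → X) '' Aᶜ) :=
      hA.compl.1.isCompact.image continuous_subtype_val
    have hd : Disjoint (((↑) : (f ⁻¹' I) → X) '' A) (((↑) : (f ⁻¹' I) → X) '' Aᶜ) :=
      (disjoint_image_iff Subtype.val_injective).mpr disjoint_compl_right
    obtain ⟨U, V, hU, hV, hAU, hBV, hUV⟩ := SeparatedNhds.of_isCompact_isCompact hAc hBc hd
    have hKW : f ⁻¹' I ⊆ (U ∩ O) ∪ V := by
      intro y hy
      by_cases hyA : (⟨y, hy⟩ : (f ⁻¹' I)) ∈ A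
      · exact Or.inl ⟨hAU ⟨_, hyA, rfl⟩, hAO hyA⟩
      · exact Or.inr (hBV ⟨_, hyA, rfl⟩)
    -- On the compact complement of the two separated open sets `f` avoids the closed set `I`, and
    -- so does every nearby `g`; its component then cannot pass from one open set to the other.
    have hev : ∀ᶠ g : C(X, ℝ) in 𝓝 f, MapsTo g ((U ∩ O) ∪ V)ᶜ Iᶜ := by
      refine (ContinuousMap.isOpen_setOfPred_mapsTo
        (((hU.inter hO).union hV).isClosed_compl.isCompact) hI.isOpen_compl).mem_nhds ?_
      intro y hy hyI
      exact hy (hKW hyI)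
    filter_upwards [hev] with g hg
    by_cases hgp : p ∈ g ⁻¹' I
    · have hsub : connectedComponentIn (g ⁻¹' I) p ⊆ (U ∩ O) ∪ V := by
        intro y hy
        by_contra hyn
        exact hg hyn (connectedComponentIn_subset (g ⁻¹' I) p hy)
      have := isPreconnected_connectedComponentIn.subset_left_of_subset_union
        (hU.inter hO) hV (hUV.mono_left inter_subset_left) hsub
        ⟨p, mem_connectedComponentIn hgp, hAU ⟨_, pA, rfl⟩, hAO pA⟩
      exact this.trans inter_subset_right
    · rw [connectedComponentIn_eq_empty hgp]
      exact empty_subset _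
  · have hev : ∀ᶠ g : C(X, ℝ) in 𝓝 f, p ∉ g ⁻¹' I :=
      (continuous_eval_const (F := C(X, ℝ)) p).continuousAt.eventually
        (hI.isOpen_compl.mem_nhds hp)
    filter_upwards [hev] with g hg
    rw [connectedComponentIn_eq_empty hg]
    exact empty_subset _

theorem isClosed_setOf_mem_connectedComponentIn_preimage [CompactSpace X] [T2Space X]
    (p q : X) {I : Set ℝ} (hI : IsClosed I) :
    IsClosed {f : C(X, ℝ) | q ∈ connectedComponentIn (f ⁻¹' I) p} := by
  rw [← isOpen_compl_iff, isOpen_iff_mem_nhds]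
  intro f hf
  filter_upwards [eventually_connectedComponentIn_preimage_subset f p hI
    (isOpen_compl_singleton (x := q)) (fun y hy hyq => hf (by rwa [← mem_singleton_iff.mp hyq]))]
    with g hg hgq
  exact hg hgq rfl

/-- The component of `p` in the band `f ⁻¹' [0, 1]`. -/
def bandComp (f : C(X, ℝ)) (p : X) : Set X := connectedComponentIn (f ⁻¹' Icc 0 1) p

/-- The diameter of the image of the component of `p` in the band `f ⁻¹' [0, 1]`. -/
def bandWidth (f : C(X, ℝ)) (p : X) : ℝ := Metric.diam (f '' bandComp f p)

theorem image_bandComp_subset (f : C(X, ℝ)) (p : X) : f '' bandComp f p ⊆ Icc 0 1 :=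
  image_subset_iff.mpr (connectedComponentIn_subset _ _)

theorem isBounded_image_bandComp (f : C(X, ℝ)) (p : X) :
    Bornology.IsBounded (f '' bandComp f p) :=
  Metric.isBounded_Icc (0 : ℝ) 1 |>.subset (image_bandComp_subset f p)

theorem bandWidth_nonneg (f : C(X, ℝ)) (p : X) : 0 ≤ bandWidth f p := Metric.diam_nonneg

theorem bandWidth_le_one (f : C(X, ℝ)) (p : X) : bandWidth f p ≤ 1 := by
  refine (Metric.diam_mono (image_bandComp_subset f p) (Metric.isBounded_Icc _ _)).trans ?_
  rw [Real.diam_Icc zero_le_one, sub_zero]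

theorem mem_bandComp_self_of_bandWidth_pos {f : C(X, ℝ)} {p : X} (h : 0 < bandWidth f p) :
    p ∈ bandComp f p := by
  by_contra hp
  have : p ∉ f ⁻¹' Icc 0 1 := fun h' => hp (mem_connectedComponentIn h')
  rw [bandWidth, bandComp, connectedComponentIn_eq_empty this, image_empty,
    Metric.diam_empty] at h
  exact lt_irrefl _ h

theorem bandComp_eq_of_mem {f : C(X, ℝ)} {p q : X} (h : q ∈ bandComp f p) :
    bandComp f q = bandComp f p :=
  (connectedComponentIn_eq h).symm

/-- A perturbation may break a component up but cannot move it out of a given neighborhood, so its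
image grows by little. -/
theorem upperSemicontinuous_bandWidth [CompactSpace X] [T2Space X] (p : X) :
    UpperSemicontinuous (fun f : C(X, ℝ) => bandWidth f p) := by
  intro f y hy
  have hy : bandWidth f p < y := hy
  obtain ⟨ε, hε, hεy⟩ : ∃ ε > 0, bandWidth f p + 2 * (2 * ε) < y :=
    ⟨(y - bandWidth f p) / 8, by linarith, by linarith⟩
  have hsub : connectedComponentIn (f ⁻¹' Icc 0 1) p ⊆
      f ⁻¹' Metric.thickening ε (f '' bandComp f p) :=
    fun q hq => Metric.self_subset_thickening hε _ (mem_image_of_mem f hq)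
  filter_upwards [eventually_connectedComponentIn_preimage_subset f p isClosed_Icc
    (Metric.isOpen_thickening.preimage f.continuous) hsub, Metric.ball_mem_nhds f hε] with g hg hd
  have hi : g '' bandComp g p ⊆ Metric.thickening (2 * ε) (f '' bandComp f p) := by
    rintro _ ⟨q, hq, rfl⟩
    obtain ⟨z, hz, hqz⟩ := Metric.mem_thickening_iff.mp (hg hq)
    refine Metric.mem_thickening_iff.mpr ⟨z, hz, ?_⟩
    have h1 : dist (g q) (f q) ≤ dist g f := ContinuousMap.dist_apply_le_dist q
    have h2 : dist g f < ε := hd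
    linarith [dist_triangle (g q) (f q) z]
  calc bandWidth g p ≤ Metric.diam (Metric.thickening (2 * ε) (f '' bandComp f p)) :=
        Metric.diam_mono hi (isBounded_image_bandComp f p).thickening
    _ ≤ bandWidth f p + 2 * (2 * ε) := Metric.diam_thickening_le _ (by positivity)
    _ < y := hεy

/-- The image is an interval; if it missed the middle it would lie in one end piece, of length `ε /
2`. -/
theorem exists_mem_bandComp_mid {f : C(X, ℝ)} {p : X} {ε : ℝ} (hε : 0 < ε)
    (h : ε ≤ bandWidth f p) : ∃ q ∈ bandComp f p, f q ∈ Icc (ε / 2) (1 - ε / 2) := by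
  by_contra! hcon
  have hc : IsPreconnected (f '' bandComp f p) :=
    isPreconnected_connectedComponentIn.image f f.continuous.continuousOn
  have hε1 : ε ≤ 1 := h.trans (bandWidth_le_one f p)
  have hlt : ∀ a ∈ f '' bandComp f p, ∀ b ∈ f '' bandComp f p, a ≤ b → b - a ≤ ε / 2 := by
    intro a ha b hb hab
    by_contra! hgt
    have ha0 := (image_bandComp_subset f p ha).1
    have hb1 := (image_bandComp_subset f p hb).2
    have key : ∃ y ∈ Icc a b, y ∈ Icc (ε / 2) (1 - ε / 2) := by
      by_cases h1 : ε / 2 ≤ a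
      · exact ⟨a, ⟨le_rfl, hab⟩, h1, by linarith⟩
      · exact ⟨ε / 2, ⟨by linarith, by linarith⟩, le_rfl, by linarith⟩
    obtain ⟨y, hy, hy'⟩ := key
    obtain ⟨q, hq, rfl⟩ := hc.Icc_subset ha hb hy
    exact hcon q hq hy'
  have : bandWidth f p ≤ ε / 2 := by
    refine Metric.diam_le_of_forall_dist_le (by positivity) ?_
    intro a ha b hb
    rw [Real.dist_eq, abs_le]
    rcases le_total a b with hab | hab
    · have := hlt a ha b hb hab
      constructor <;> linarith
    · have := hlt b hb a ha hab
      constructor <;> linarith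
  linarith

/-- The function `f` shifted down by the integer `j`. -/
def shift (f : C(X, ℝ)) (j : ℤ) : C(X, ℝ) := f - ContinuousMap.const X (j : ℝ)

@[simp] theorem shift_apply (f : C(X, ℝ)) (j : ℤ) (p : X) : shift f j p = f p - j := rfl

theorem continuous_shift (j : ℤ) : Continuous (fun f : C(X, ℝ) => shift f j) := by
  unfold shift; fun_prop

/-- A wide component reaches the middle of its band. There it swallows a whole member of a fixed
finite cover by connected open sets on which `f` is nearly constant, hence the dense point chosen in
that member. The cover depends on `f` only, so one `T` serves all nearby `g`. -/
theorem exists_finset_representatives [CompactSpace X] [LocallyConnectedSpace X]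
    {u : ℕ → X} (hu : DenseRange u) (f : C(X, ℝ)) {ε : ℝ} (hε : 0 < ε) :
    ∃ T : Finset (ℕ × ℤ), ∀ᶠ g : C(X, ℝ) in 𝓝 f, ∀ (j : ℤ) (p : X),
      ε ≤ bandWidth (shift g j) p → ∃ i ∈ T, i.2 = j ∧
        bandComp (shift g j) (u i.1) = bandComp (shift g j) p ∧
        shift g j (u i.1) ∈ Icc (ε / 4) (1 - ε / 4) := by
  have hloc : ∀ p : X, ∃ U : Set X, IsOpen U ∧ p ∈ U ∧ IsPreconnected U ∧
      ∀ q ∈ U, dist (f q) (f p) < ε / 16 := by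
    intro p
    have hn : f ⁻¹' Metric.ball (f p) (ε / 16) ∈ 𝓝 p :=
      f.continuous.continuousAt.preimage_mem_nhds (Metric.ball_mem_nhds _ (by positivity))
    obtain ⟨U, hUs, hU, hpU, hUc⟩ :=
      locallyConnectedSpace_iff_subsets_isOpen_isConnected.mp inferInstance p _ hn
    exact ⟨U, hU, hpU, hUc.isPreconnected, fun q hq => hUs hq⟩
  choose U hU hpU hUc hUd using hloc
  obtain ⟨R, hR⟩ := isCompact_univ.elim_finite_subcover U hU
    (fun p _ => mem_iUnion.mpr ⟨p, hpU p⟩)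
  have hrep : ∀ p : X, ∃ n, u n ∈ U p := fun p => hu.exists_mem_open (hU p) ⟨p, hpU p⟩
  choose r hr using hrep
  obtain ⟨B, hB⟩ : ∃ B : ℕ, ‖f‖ + 2 + ε ≤ B := exists_nat_ge _
  refine ⟨(R.image r) ×ˢ Finset.Icc (-(B : ℤ)) B, ?_⟩
  filter_upwards [Metric.ball_mem_nhds f (show 0 < ε / 16 by positivity)] with g hg j p hw
  have hgf : ∀ q, |g q - f q| < ε / 16 := fun q =>
    (ContinuousMap.dist_apply_le_dist (f := g) (g := f) q).trans_lt hg
  obtain ⟨q, hq, hqm⟩ := exists_mem_bandComp_mid hε hw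
  obtain ⟨a, haR, hqa⟩ : ∃ a ∈ R, q ∈ U a := by
    have := hR (mem_univ q)
    simpa using this
  -- Going from `g q` to `g y` through `f q`, `f a`, `f y` costs four errors below `ε / 16`, which
  -- leaves a margin `ε / 4` out of `ε / 2`.
  have hUband : ∀ y ∈ U a, shift g j y ∈ Icc (ε / 4) (1 - ε / 4) := by
    intro y hy
    have h1 := abs_lt.mp (hgf y)
    have h2 := abs_lt.mp (hgf q)
    have h3 := abs_lt.mp (hUd a y hy)
    have h4 := abs_lt.mp (hUd a q hqa)
    simp only [shift_apply, mem_Icc] at hqm ⊢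
    constructor <;> linarith [hqm.1, hqm.2]
  have hUsub : U a ⊆ bandComp (shift g j) q := by
    refine (hUc a).subset_connectedComponentIn hqa fun y hy => ?_
    have := hUband y hy
    exact ⟨by linarith [this.1], by linarith [this.2]⟩
  refine ⟨(r a, j), ?_, rfl, ?_, hUband _ (hr a)⟩
  · have h1 := hUband _ (hr a)
    have h2 := abs_lt.mp (hgf (u (r a)))
    have h3 := abs_le.mp (f.norm_coe_le_norm (u (r a)))
    simp only [shift_apply, mem_Icc] at h1
    refine Finset.mem_product.mpr ⟨Finset.mem_image_of_mem r haR, Finset.mem_Icc.mpr ⟨?_, ?_⟩⟩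
    · have : (-(B : ℝ)) ≤ j := by linarith [h1.1, h1.2]
      exact_mod_cast this
    · have : (j : ℝ) ≤ B := by linarith [h1.1, h1.2]
      exact_mod_cast this
  · rw [← bandComp_eq_of_mem hq]
    exact bandComp_eq_of_mem (hUsub (hr a))

end Components

/-! ### Geometrically discounted sums of finite lists -/

section GeomSum

/-- The sum `a₀ + a₁ / 2 + a₂ / 4 + ⋯` of a finite list. -/
def geomSum : List ℝ → ℝ
  | [] => 0
  | a :: l => a + geomSum l / 2

theorem geomSum_nonneg : ∀ {l : List ℝ}, (∀ a ∈ l, 0 ≤ a) → 0 ≤ geomSum l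
  | [], _ => le_rfl
  | a :: l, h => by
    have h1 := h a List.mem_cons_self
    have h2 : 0 ≤ geomSum l := geomSum_nonneg fun b hb => h b (List.mem_cons_of_mem _ hb)
    simp only [geomSum]
    positivity

theorem geomSum_le_two : ∀ {l : List ℝ}, (∀ a ∈ l, a ≤ 1) → geomSum l ≤ 2
  | [], _ => zero_le_two
  | a :: l, h => by
    have h1 := h a List.mem_cons_self
    have h2 : geomSum l ≤ 2 := geomSum_le_two fun b hb => h b (List.mem_cons_of_mem _ hb)
    simp only [geomSum]
    linarith

theorem geomSum_append_singleton (l : List ℝ) (a : ℝ) :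
    geomSum (l ++ [a]) = geomSum l + a / 2 ^ l.length := by
  induction l with
  | nil => simp [geomSum]
  | cons b l ih =>
    simp only [List.cons_append, geomSum, ih, List.length_cons, pow_succ]
    field_simp
    ring

/-- Deleting a term moves the later ones to larger weights, so only the deleted terms are lost, at
most `ε * (1 + 1 / 2 + ⋯)`. -/
theorem geomSum_map_le_filter {ι : Type*} (w : ι → ℝ) {ε : ℝ} (hε : 0 ≤ ε) (s : List ι) :
    geomSum (s.map w) ≤ geomSum ((s.filter (fun i => ε ≤ w i)).map w) + 2 * ε := by
  induction s with
  | nil => simp [geomSum, hε]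
  | cons i s ih =>
    by_cases hi : ε ≤ w i
    · rw [List.filter_cons_of_pos (by simpa using hi)]
      simp only [List.map_cons, geomSum]
      linarith
    · rw [List.filter_cons_of_neg (by simpa using hi)]
      simp only [List.map_cons, geomSum]
      have hs : geomSum (s.map w) ≤ 2 * geomSum ((s.filter (fun i => ε ≤ w i)).map w) + 2 * ε := by
        have : 0 ≤ geomSum ((s.filter (fun i => ε ≤ w i)).map w) := by
          refine geomSum_nonneg fun a ha => ?_
          obtain ⟨k, hk, rfl⟩ := List.mem_map.mp ha
          have := (List.mem_filter.mp hk).2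
          exact hε.trans (by simpa using this)
        linarith
      linarith [not_le.mp hi]

theorem tendsto_geomSum_map {ι α : Type*} {l : Filter α} {w : α → ι → ℝ} {v : ι → ℝ} (s : List ι)
    (h : ∀ i ∈ s, Tendsto (fun a => w a i) l (𝓝 (v i))) :
    Tendsto (fun a => geomSum (s.map (w a))) l (𝓝 (geomSum (s.map v))) := by
  induction s with
  | nil => exact tendsto_const_nhds
  | cons i s ih =>
    simp only [List.map_cons, geomSum]
    exact (h i List.mem_cons_self).add
      ((ih fun k hk => h k (List.mem_cons_of_mem _ hk)).div_const 2)

theorem measurable_geomSum_map {ι α : Type*} [MeasurableSpace α] {w : α → ι → ℝ} (s : List ι)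
    (h : ∀ i, Measurable (fun a => w a i)) : Measurable (fun a => geomSum (s.map (w a))) := by
  induction s with
  | nil => exact measurable_const
  | cons i s ih =>
    simp only [List.map_cons, geomSum]
    exact (h i).add (ih.div_const 2)

end GeomSum

/-! ### The supremum over lists of components: measurability and continuity -/

section BandSum

variable {X : Type*} [TopologicalSpace X]

/-- The component of `u n` in the band `f ⁻¹' [j, j + 1]`, for `i = (n, j)`. -/
def indexComp (u : ℕ → X) (f : C(X, ℝ)) (i : ℕ × ℤ) : Set X := bandComp (shift f i.2) (u i.1)

/-- The diameter of the image of `indexComp u f i`. -/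
def indexWidth (u : ℕ → X) (f : C(X, ℝ)) (i : ℕ × ℤ) : ℝ := bandWidth (shift f i.2) (u i.1)

/-- The indices in the list stand for distinct components, of positive width. -/
def Admissible (u : ℕ → X) (f : C(X, ℝ)) (s : List (ℕ × ℤ)) : Prop :=
  (∀ i ∈ s, 0 < indexWidth u f i) ∧
    s.Pairwise fun i k => i.2 = k.2 → u k.1 ∉ indexComp u f i

open Classical in
/-- The supremum of `geomSum` over the widths of lists of distinct components. -/
def bandSum (u : ℕ → X) (f : C(X, ℝ)) : ℝ :=
  ⨆ s : List (ℕ × ℤ), if Admissible u f s then geomSum (s.map (indexWidth u f)) else 0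

theorem geomSum_indexWidth_le_two (u : ℕ → X) (f : C(X, ℝ)) (s : List (ℕ × ℤ)) :
    geomSum (s.map (indexWidth u f)) ≤ 2 := by
  refine geomSum_le_two fun a ha => ?_
  obtain ⟨i, _, rfl⟩ := List.mem_map.mp ha
  exact bandWidth_le_one _ _

theorem le_bandSum {u : ℕ → X} {f : C(X, ℝ)} {s : List (ℕ × ℤ)} (hs : Admissible u f s) :
    geomSum (s.map (indexWidth u f)) ≤ bandSum u f := by
  classical
  have hb : BddAbove (range fun s : List (ℕ × ℤ) =>
      if Admissible u f s then geomSum (s.map (indexWidth u f)) else 0) := by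
    refine ⟨2, ?_⟩
    rintro _ ⟨s, rfl⟩
    dsimp only
    split_ifs
    · exact geomSum_indexWidth_le_two u f s
    · exact zero_le_two
  have := le_ciSup hb s
  simp only [hs, if_true] at this
  unfold bandSum
  convert this

theorem bandSum_le {u : ℕ → X} {f : C(X, ℝ)} {c : ℝ} (hc : 0 ≤ c)
    (h : ∀ s, Admissible u f s → geomSum (s.map (indexWidth u f)) ≤ c) : bandSum u f ≤ c := by
  refine ciSup_le fun s => ?_
  split_ifs with hs
  · exact h s hs
  · exact hc

theorem bandSum_nonneg (u : ℕ → X) (f : C(X, ℝ)) : 0 ≤ bandSum u f :=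
  le_bandSum (s := []) ⟨by simp, List.Pairwise.nil⟩

theorem bandSum_le_two (u : ℕ → X) (f : C(X, ℝ)) : bandSum u f ≤ 2 :=
  bandSum_le zero_le_two fun s _ => geomSum_indexWidth_le_two u f s

theorem exists_lt_of_lt_bandSum {u : ℕ → X} {f : C(X, ℝ)} {c : ℝ} (h : c < bandSum u f) :
    ∃ s, Admissible u f s ∧ c < geomSum (s.map (indexWidth u f)) := by
  obtain ⟨s, hs⟩ := exists_lt_of_lt_ciSup h
  split_ifs at hs with hadm
  · exact ⟨s, hadm, hs⟩
  -- The default `0` of an inadmissible list is also the value of the empty list, which is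
  -- admissible.
  · exact ⟨[], ⟨by simp, List.Pairwise.nil⟩, hs⟩

theorem isClosed_setOf_mem_indexComp [CompactSpace X] [T2Space X]
    (u : ℕ → X) (i : ℕ × ℤ) (q : X) :
    IsClosed {f : C(X, ℝ) | q ∈ indexComp u f i} :=
  (isClosed_setOf_mem_connectedComponentIn_preimage (u i.1) q isClosed_Icc).preimage
    (continuous_shift i.2)

theorem upperSemicontinuous_indexWidth [CompactSpace X] [T2Space X]
    (u : ℕ → X) (i : ℕ × ℤ) :
    UpperSemicontinuous fun f : C(X, ℝ) => indexWidth u f i :=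
  (upperSemicontinuous_bandWidth (u i.1)).comp (continuous_shift i.2)

/-- There are countably many lists; widths are upper semicontinuous and membership in a component is
a closed condition, so every term of the supremum is measurable. -/
theorem measurable_bandSum_comp [CompactSpace X] [T2Space X] {Θ : Type*} [TopologicalSpace Θ] [MeasurableSpace Θ]
    [OpensMeasurableSpace Θ] (u : ℕ → X) {Φ : Θ → C(X, ℝ)} (hΦ : Continuous Φ) :
    Measurable fun θ => bandSum u (Φ θ) := by
  classical
  have hw : ∀ i, Measurable fun θ => indexWidth u (Φ θ) i := fun i =>
    ((upperSemicontinuous_indexWidth u i).comp hΦ).measurable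
  have hm : ∀ i q, MeasurableSet {θ | q ∉ indexComp u (Φ θ) i} := fun i q =>
    ((isClosed_setOf_mem_indexComp u i q).preimage hΦ).measurableSet.compl
  have hadm : ∀ s : List (ℕ × ℤ), MeasurableSet {θ | Admissible u (Φ θ) s} := by
    intro s
    induction s with
    | nil => simp [Admissible]
    | cons i s ih =>
      have : {θ | Admissible u (Φ θ) (i :: s)} = {θ | Admissible u (Φ θ) s} ∩
          ({θ | 0 < indexWidth u (Φ θ) i} ∩
            ⋂ k : ℕ × ℤ, ⋂ _ : k ∈ s ∧ i.2 = k.2, {θ | u k.1 ∉ indexComp u (Φ θ) i}) := by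
        ext θ
        simp only [Admissible, List.mem_cons, forall_eq_or_imp, List.pairwise_cons, mem_ofPred_eq,
          mem_inter_iff, mem_iInter, and_imp]
        tauto
      rw [this]
      exact ih.inter ((measurableSet_lt measurable_const (hw i)).inter
        (MeasurableSet.iInter fun k => MeasurableSet.iInter fun _ => hm i _))
  unfold bandSum
  refine Measurable.iSup fun s => ?_
  exact Measurable.ite (hadm s) (measurable_geomSum_map s hw) measurable_const

/-- Points `u m`, `u n` in one component of a closed band `[j, j + 1]` already lie in one
component of a slightly smaller band. -/
def IsRegular (u : ℕ → X) (f : C(X, ℝ)) : Prop :=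
  ∀ (i : ℕ × ℤ) (n : ℕ), u n ∈ indexComp u f i →
    ∃ k : ℕ, u n ∈ connectedComponentIn
      (shift f i.2 ⁻¹' Icc (1 / (k + 1 : ℝ)) (1 - 1 / (k + 1 : ℝ))) (u i.1)

/-- A connected set in the smaller band of `f` stays in the full band of any `g` closer to `f` than
the margin. -/
theorem IsRegular.eventually_mem_indexComp [CompactSpace X]
    {u : ℕ → X} {f : C(X, ℝ)} (hf : IsRegular u f)
    {i : ℕ × ℤ} {n : ℕ} (h : u n ∈ indexComp u f i) :
    ∀ᶠ g : C(X, ℝ) in 𝓝 f, u n ∈ indexComp u g i := by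
  obtain ⟨k, hk⟩ := hf i n h
  have hpos : (0 : ℝ) < 1 / (k + 1 : ℝ) := by positivity
  filter_upwards [Metric.ball_mem_nhds f hpos] with g hg
  have hi : u i.1 ∈ shift f i.2 ⁻¹' Icc (1 / (k + 1 : ℝ)) (1 - 1 / (k + 1 : ℝ)) :=
    connectedComponentIn_nonempty_iff.mp ⟨_, hk⟩
  refine isPreconnected_connectedComponentIn.subset_connectedComponentIn
    (mem_connectedComponentIn hi) ?_ hk
  intro y hy
  have hy' := connectedComponentIn_subset _ _ hy
  have h1 := abs_lt.mp ((ContinuousMap.dist_apply_le_dist (f := g) (g := f) y).trans_lt hg)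
  simp only [mem_preimage, shift_apply, mem_Icc] at hy' ⊢
  constructor <;> linarith [hy'.1, hy'.2]

/-- Lower semicontinuity: two dense points of the component nearly realize the diameter, and by
regularity they remain in the component of `u i.1` for nearby functions. -/
theorem IsRegular.eventually_lt_indexWidth [CompactSpace X] [LocallyConnectedSpace X]
    {u : ℕ → X} (hu : DenseRange u) {f : C(X, ℝ)}
    (hf : IsRegular u f) {i : ℕ × ℤ} {c : ℝ} (hc : c < indexWidth u f i)
    (hpos : 0 < indexWidth u f i) : ∀ᶠ g : C(X, ℝ) in 𝓝 f, c < indexWidth u g i := by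
  set F := shift f i.2 with hF
  obtain ⟨a, ha, b, hb, hab⟩ : ∃ a ∈ F '' indexComp u f i, ∃ b ∈ F '' indexComp u f i,
      max c 0 < b - a := by
    by_contra! hcon
    have : indexWidth u f i ≤ max c 0 := by
      refine Metric.diam_le_of_forall_dist_le (le_max_right _ _) fun a ha b hb => ?_
      rw [Real.dist_eq, abs_le]
      exact ⟨by linarith [hcon a ha b hb], by linarith [hcon b hb a ha]⟩
    exact absurd this (not_le.mpr (max_lt hc hpos))
  -- The eight `δ`: four for staying `2 * δ` away from `a` and `b`, two for approximation by dense
  -- points, two for replacing `f` by `g`.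
  obtain ⟨δ, hδ, hδ'⟩ : ∃ δ > 0, max c 0 + 8 * δ = b - a :=
    ⟨(b - a - max c 0) / 8, by linarith, by ring⟩
  have hc0 : 0 ≤ max c 0 := le_max_right _ _
  have ha0 := (image_bandComp_subset F _ ha).1
  have hb1 := (image_bandComp_subset F _ hb).2
  have happrox : ∀ y ∈ Icc (a + 2 * δ) (b - 2 * δ), ∃ n, u n ∈ indexComp u f i ∧
      |F (u n) - y| < δ := by
    intro y hy
    have hconn : IsPreconnected (F '' indexComp u f i) :=
      isPreconnected_connectedComponentIn.image F F.continuous.continuousOn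
    obtain ⟨q, hq, hqy⟩ := hconn.Icc_subset ha hb
      (⟨by linarith [hy.1], by linarith [hy.2]⟩ : y ∈ Icc a b)
    obtain ⟨U, hUs, hU, hqU, hUc⟩ := locallyConnectedSpace_iff_subsets_isOpen_isConnected.mp
      inferInstance q (F ⁻¹' Metric.ball y δ) (F.continuous.continuousAt.preimage_mem_nhds
        (by rw [hqy]; exact Metric.ball_mem_nhds _ hδ))
    obtain ⟨n, hn⟩ := hu.exists_mem_open hU ⟨q, hqU⟩
    refine ⟨n, ?_, hUs hn⟩
    have hsub : U ⊆ bandComp F q := by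
      refine hUc.isPreconnected.subset_connectedComponentIn hqU fun z hz => ?_
      have h1 := abs_lt.mp (show |F z - y| < δ from hUs hz)
      constructor <;> linarith [hy.1, hy.2]
    have h2 := hsub hn
    rwa [bandComp_eq_of_mem (show q ∈ bandComp F (u i.1) from hq)] at h2
  obtain ⟨m, hm, hma⟩ := happrox (a + 2 * δ) ⟨le_rfl, by linarith⟩
  obtain ⟨n, hn, hnb⟩ := happrox (b - 2 * δ) ⟨by linarith, le_rfl⟩
  filter_upwards [hf.eventually_mem_indexComp hm, hf.eventually_mem_indexComp hn,
    Metric.ball_mem_nhds f hδ] with g hgm hgn hg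
  have h1 := abs_lt.mp ((ContinuousMap.dist_apply_le_dist (f := g) (g := f) (u m)).trans_lt hg)
  have h2 := abs_lt.mp ((ContinuousMap.dist_apply_le_dist (f := g) (g := f) (u n)).trans_lt hg)
  have h3 := abs_lt.mp hma
  have h4 := abs_lt.mp hnb
  have h5 : dist (shift g i.2 (u n)) (shift g i.2 (u m)) ≤ indexWidth u g i :=
    Metric.dist_le_diam_of_mem (isBounded_image_bandComp _ _)
      (mem_image_of_mem _ hgn) (mem_image_of_mem _ hgm)
  rw [Real.dist_eq] at h5
  have h6 := (le_abs_self _).trans h5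
  simp only [hF, shift_apply] at h3 h4 h6
  linarith [le_max_left c 0]

theorem IsRegular.tendsto_indexWidth [CompactSpace X] [T2Space X] [LocallyConnectedSpace X]
    {u : ℕ → X} (hu : DenseRange u) {f : C(X, ℝ)}
    (hf : IsRegular u f) {i : ℕ × ℤ} (hpos : 0 < indexWidth u f i) :
    Tendsto (fun g : C(X, ℝ) => indexWidth u g i) (𝓝 f) (𝓝 (indexWidth u f i)) :=
  tendsto_order.mpr ⟨fun _ hc => hf.eventually_lt_indexWidth hu hc hpos,
    fun c hc => upperSemicontinuous_indexWidth u i f c hc⟩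

theorem Admissible.nodup {u : ℕ → X} {f : C(X, ℝ)} {s : List (ℕ × ℤ)} (hs : Admissible u f s) :
    s.Nodup := by
  refine hs.2.imp_of_mem fun {i k} hi _ h hik => ?_
  subst hik
  exact h rfl (mem_bandComp_self_of_bandWidth_pos (hs.1 i hi))

theorem finite_setOf_nodup_list_subset {ι : Type*} (T : Finset ι) :
    {s : List ι | s.Nodup ∧ ∀ i ∈ s, i ∈ T}.Finite := by
  refine ((List.finite_length_le T T.card).image (List.map Subtype.val)).subset ?_
  rintro s ⟨hs, hsT⟩
  refine ⟨s.attach.map fun i => ⟨i.1, hsT i.1 i.2⟩, ?_, ?_⟩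
  · classical
    have : s.toFinset.card ≤ T.card :=
      Finset.card_le_card fun i hi => hsT i (List.mem_toFinset.mp hi)
    rw [List.toFinset_card_of_nodup hs] at this
    simpa using this
  · simp [Function.comp_def]

/-- Replacing the indices of an admissible list by others for the same components. -/
theorem Admissible.map {u : ℕ → X} {f : C(X, ℝ)} {s : List (ℕ × ℤ)} (hs : Admissible u f s)
    {ρ : ℕ × ℤ → ℕ × ℤ} (h2 : ∀ i ∈ s, (ρ i).2 = i.2)
    (hρ : ∀ i ∈ s, indexComp u f (ρ i) = indexComp u f i) :
    Admissible u f (s.map ρ) ∧ (s.map ρ).map (indexWidth u f) = s.map (indexWidth u f) := by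
  have hw : ∀ i ∈ s, indexWidth u f (ρ i) = indexWidth u f i := by
    intro i hi
    have := hρ i hi
    unfold indexComp at this
    unfold indexWidth bandWidth
    rw [this, h2 i hi]
  refine ⟨⟨?_, ?_⟩, ?_⟩
  · intro k hk
    obtain ⟨i, hi, rfl⟩ := List.mem_map.mp hk
    rw [hw i hi]
    exact hs.1 i hi
  · rw [List.pairwise_map]
    refine hs.2.imp_of_mem fun {i k} hi hk h hik hmem => ?_
    rw [h2 i hi, h2 k hk] at hik
    refine h hik ?_
    rw [hρ i hi] at hmem
    have h3 : indexComp u f (ρ k) = indexComp u f i := by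
      have := bandComp_eq_of_mem hmem
      unfold indexComp
      rw [h2 k hk, ← hik]
      exact this
    rw [← h3, hρ k hk]
    exact mem_bandComp_self_of_bandWidth_pos (hs.1 k hk)
  · rw [List.map_map]
    exact List.map_congr_left hw

/-- A list admissible for `f` has converging widths. Any other list is excluded near `f`: either two
indices share a component, which persists by regularity, or some width vanishes at `f` and stays
below `ε`. -/
theorem IsRegular.eventually_geomSum_lt [CompactSpace X] [T2Space X] [LocallyConnectedSpace X]
    {u : ℕ → X} (hu : DenseRange u) {f : C(X, ℝ)}
    (hf : IsRegular u f) {ε : ℝ} (hε : 0 < ε) (s : List (ℕ × ℤ)) :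
    ∀ᶠ g : C(X, ℝ) in 𝓝 f, Admissible u g s → (∀ i ∈ s, ε ≤ indexWidth u g i) →
      geomSum (s.map (indexWidth u g)) < bandSum u f + ε := by
  by_cases hs : Admissible u f s
  · have ht := tendsto_geomSum_map (w := indexWidth u) s
      fun i hi => hf.tendsto_indexWidth hu (hs.1 i hi)
    filter_upwards [(tendsto_order.mp ht).2 (bandSum u f + ε) (by linarith [le_bandSum hs])]
      with g hg _ _ using hg
  · by_cases h1 : ∀ i ∈ s, 0 < indexWidth u f i
    · have h2 : ¬ s.Pairwise fun i k => i.2 = k.2 → u k.1 ∉ indexComp u f i := fun h => hs ⟨h1, h⟩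
      rw [List.pairwise_iff_getElem] at h2
      push Not at h2
      obtain ⟨a, b, ha, hb, hab, he, hmem⟩ := h2
      filter_upwards [hf.eventually_mem_indexComp hmem] with g hg hadm _
      exact absurd hg (List.pairwise_iff_getElem.mp hadm.2 a b ha hb hab he)
    · push Not at h1
      obtain ⟨i, hi, hwi⟩ := h1
      filter_upwards [upperSemicontinuous_indexWidth u i f ε (hwi.trans_lt hε)] with g hg _ hw
      exact absurd (hw i hi) (not_le.mpr hg)

theorem IsRegular.continuousAt_bandSum [CompactSpace X] [T2Space X] [LocallyConnectedSpace X]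
    {u : ℕ → X} (hu : DenseRange u) {f : C(X, ℝ)}
    (hf : IsRegular u f) : ContinuousAt (bandSum u) f := by
  refine tendsto_order.mpr ⟨fun c hc => ?_, fun c hc => ?_⟩
  · obtain ⟨s, hs, hcs⟩ := exists_lt_of_lt_bandSum hc
    have ht := tendsto_geomSum_map (w := indexWidth u) s
      fun i hi => hf.tendsto_indexWidth hu (hs.1 i hi)
    have h1 : ∀ᶠ g : C(X, ℝ) in 𝓝 f, ∀ i ∈ s, 0 < indexWidth u g i := by
      have := (List.finite_toSet s).eventually_all (l := 𝓝 f)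
        (p := fun i (g : C(X, ℝ)) => 0 < indexWidth u g i)
      exact this.mpr fun i hi => hf.eventually_lt_indexWidth hu (hs.1 i hi) (hs.1 i hi)
    have h2 : ∀ᶠ g : C(X, ℝ) in 𝓝 f, s.Pairwise fun i k => i.2 = k.2 → u k.1 ∉ indexComp u g i := by
      have h3 : ∀ i k : ℕ × ℤ, ∀ᶠ g : C(X, ℝ) in 𝓝 f,
          (i.2 = k.2 → u k.1 ∉ indexComp u f i) → i.2 = k.2 → u k.1 ∉ indexComp u g i := by
        intro i k
        by_cases hik : i.2 = k.2 → u k.1 ∉ indexComp u f i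
        · by_cases he : i.2 = k.2
          · filter_upwards [(isClosed_setOf_mem_indexComp u i (u k.1)).isOpen_compl.mem_nhds
              (hik he)] with g hg _ _ using hg
          · exact Eventually.of_forall fun g _ h => absurd h he
        · exact Eventually.of_forall fun g h => absurd h hik
      have h4 := ((List.finite_toSet s).prod (List.finite_toSet s)).eventually_all (l := 𝓝 f)
        (p := fun (x : (ℕ × ℤ) × (ℕ × ℤ)) (g : C(X, ℝ)) =>
          (x.1.2 = x.2.2 → u x.2.1 ∉ indexComp u f x.1) →
            x.1.2 = x.2.2 → u x.2.1 ∉ indexComp u g x.1)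
      filter_upwards [h4.mpr fun x _ => h3 x.1 x.2] with g hg
      exact hs.2.imp_of_mem fun {i k} hi hk h => hg (i, k) ⟨hi, hk⟩ h
    filter_upwards [(tendsto_order.mp ht).1 c hcs, h1, h2] with g hg hg1 hg2
    exact hg.trans_le (le_bandSum ⟨hg1, hg2⟩)
  -- Of the three `ε`, two pay for discarding widths below `ε`, and one for the bound over the
  -- finitely many duplicate-free lists from `T`.
  · obtain ⟨ε, hε, hεc⟩ : ∃ ε > 0, bandSum u f + 3 * ε < c :=
      ⟨(c - bandSum u f) / 4, by linarith, by linarith⟩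
    obtain ⟨T, hT⟩ := exists_finset_representatives hu f hε
    have hall := (finite_setOf_nodup_list_subset T).eventually_all (l := 𝓝 f)
      (p := fun s (g : C(X, ℝ)) => Admissible u g s → (∀ i ∈ s, ε ≤ indexWidth u g i) →
        geomSum (s.map (indexWidth u g)) < bandSum u f + ε)
    filter_upwards [hT, hall.mpr fun s _ => hf.eventually_geomSum_lt hu hε s] with g hgT hg
    refine (bandSum_le (c := bandSum u f + 3 * ε) (by linarith [bandSum_nonneg u f])
      fun s hs => ?_).trans_lt hεc
    set s' := s.filter (fun i => ε ≤ indexWidth u g i) with hs'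
    have hmem : ∀ i ∈ s', ε ≤ indexWidth u g i := fun i hi => by
      have := (List.mem_filter.mp hi).2
      simpa using this
    have hadm : Admissible u g s' :=
      ⟨fun i hi => hε.trans_le (hmem i hi), hs.2.filter _⟩
    have hrep : ∀ i : ℕ × ℤ, ε ≤ indexWidth u g i → ∃ k ∈ T, k.2 = i.2 ∧
        indexComp u g k = indexComp u g i := by
      intro i hi
      obtain ⟨k, hk, hk2, he, -⟩ := hgT i.2 (u i.1) hi
      refine ⟨k, hk, hk2, ?_⟩
      unfold indexComp
      rw [hk2, he]
    choose! ρ hρT hρ2 hρc using hrep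
    obtain ⟨hadm', hmap⟩ := hadm.map (fun i hi => hρ2 i (hmem i hi)) (fun i hi => hρc i (hmem i hi))
    have hlt := hg (s'.map ρ) ⟨hadm'.nodup, fun i hi => by
      obtain ⟨k, hk, rfl⟩ := List.mem_map.mp hi
      exact hρT k (hmem k hk)⟩ hadm' (fun i hi => by
      have : indexWidth u g i ∈ (s'.map ρ).map (indexWidth u g) := List.mem_map_of_mem hi
      rw [hmap] at this
      obtain ⟨k, hk, hke⟩ := List.mem_map.mp this
      rw [← hke]
      exact hmem k hk)
    rw [hmap] at hlt
    have := geomSum_map_le_filter (indexWidth u g) hε.le s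
    linarith

end BandSum

/-! ### Ordered enumerations and rearrangement -/

section Enumeration

/-- A set with finitely many members of weight `≥ ε` for each `ε > 0` can be listed by
non-increasing weight, padding with an element of weight `0`. -/
theorem exists_antitone_enumeration {α : Type*} {S : Set α} {v : α → ℝ} {o : α}
    (hnn : ∀ a, 0 ≤ v a) (hpos : ∀ a ∈ S, 0 < v a) (ho : v o = 0)
    (hfin : ∀ ε > 0, {a ∈ S | ε ≤ v a}.Finite) :
    ∃ e : ℕ → α, (∀ n, e n ∈ S ∨ e n = o) ∧ (∀ a ∈ S, ∃ n, e n = a) ∧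
      (∀ m n, e m ∈ S → e m = e n → m = n) ∧ ∀ n, v (e (n + 1)) ≤ v (e n) := by
  classical
  have hnext : ∀ A : Finset α, ∃ b, ((b ∈ S ∧ b ∉ A) ∨ (b = o ∧ ∀ a ∈ S, a ∈ A)) ∧
      ∀ a ∈ S, a ∉ A → v a ≤ v b := by
    intro A
    by_cases h : ∃ a ∈ S, a ∉ A
    · obtain ⟨a, haS, haA⟩ := h
      have hf : {b ∈ S | v a ≤ v b ∧ b ∉ A}.Finite :=
        (hfin (v a) (hpos a haS)).subset fun b hb => ⟨hb.1, hb.2.1⟩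
      obtain ⟨b, hb, hmax⟩ := hf.exists_maximalFor v _ ⟨a, haS, le_rfl, haA⟩
      refine ⟨b, Or.inl ⟨hb.1, hb.2.2⟩, fun c hcS hcA => ?_⟩
      by_contra! hlt
      exact absurd (hmax (j := c) ⟨hcS, hb.2.1.trans hlt.le, hcA⟩ hlt.le) (not_le.mpr hlt)
    · push Not at h
      exact ⟨o, Or.inr ⟨rfl, h⟩, fun a ha ha' => absurd (h a ha) ha'⟩
  choose next hnext hmax using hnext
  let A : ℕ → Finset α := fun n => Nat.rec ∅ (fun _ B => insert (next B) B) n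
  have hA : ∀ n, A (n + 1) = insert (next (A n)) (A n) := fun _ => rfl
  have hmono : Monotone A := monotone_nat_of_le_succ fun n => by
    rw [hA]; exact Finset.subset_insert _ _
  have hin : ∀ m n, m < n → next (A m) ∈ A n := fun m n hmn =>
    hmono (Nat.succ_le_of_lt hmn) (by rw [Nat.succ_eq_add_one, hA]; exact Finset.mem_insert_self _ _)
  have hinj : ∀ m n, next (A m) ∈ S → next (A m) = next (A n) → m = n := by
    intro m n hm hmn
    have hout : ∀ k, next (A k) ∈ S → next (A k) ∉ A k := by
      intro k hk
      rcases hnext (A k) with h | h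
      · exact h.2
      · have : 0 < v (next (A k)) := hpos _ hk
        rw [h.1, ho] at this
        exact absurd this (lt_irrefl _)
    rcases lt_trichotomy m n with h | h | h
    · exact absurd (hmn ▸ hin m n h) (hout n (hmn ▸ hm))
    · exact h
    · exact absurd (hmn ▸ hin n m h) (hout m hm)
  refine ⟨fun n => next (A n), fun n => (hnext (A n)).imp And.left And.left, ?_, hinj, ?_⟩
  · intro a ha
    by_contra! hne
    have haA : ∀ n, a ∉ A n := by
      intro n
      induction n with
      | zero => exact Finset.notMem_empty a
      | succ n ih =>
        rw [hA, Finset.mem_insert, not_or]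
        exact ⟨(hne n).symm, ih⟩
    have hS : ∀ n, next (A n) ∈ S := by
      intro n
      rcases hnext (A n) with h | h
      · exact h.1
      · exact absurd (h.2 a ha) (haA n)
    -- If `a` were never chosen, infinitely many distinct elements of weight at least `v a` would
    -- be.
    have hinj' : Function.Injective fun n => next (A n) := fun m n h => hinj m n (hS m) h
    exact (infinite_range_of_injective hinj') ((hfin (v a) (hpos a ha)).subset (by
      rintro _ ⟨n, rfl⟩
      exact ⟨hS n, hmax (A n) a ha (haA n)⟩))
  · intro n
    rcases hnext (A (n + 1)) with h | h
    · exact hmax (A n) _ h.1 fun h' => h.2 (hmono n.le_succ h')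
    · dsimp only
      rw [h.1, ho]
      exact hnn _

theorem sum_le_sum_range_of_antitone {w : ℕ → ℝ} (hw : Antitone w) (h0 : ∀ n, 0 ≤ w n)
    {k : ℕ} {s : Finset ℕ} (hs : s.card ≤ k) : ∑ n ∈ s, w n ≤ ∑ n ∈ Finset.range k, w n := by
  have h1 : ∑ n ∈ s \ Finset.range k, w n ≤ (s \ Finset.range k).card • w k :=
    Finset.sum_le_card_nsmul _ _ _ fun n hn => hw (by
      have := (Finset.mem_sdiff.mp hn).2
      simpa using this)
  have h2 : (Finset.range k \ s).card • w k ≤ ∑ n ∈ Finset.range k \ s, w n :=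
    Finset.card_nsmul_le_sum _ _ _ fun n hn => hw (by
      have := (Finset.mem_sdiff.mp hn).1
      exact (Finset.mem_range.mp this).le)
  have h3 : (s \ Finset.range k).card ≤ (Finset.range k \ s).card := by
    refine Finset.card_sdiff_le_card_sdiff_iff.mpr ?_
    simpa using hs
  have h4 : (s \ Finset.range k).card • w k ≤ (Finset.range k \ s).card • w k :=
    nsmul_le_nsmul_left (h0 k) h3
  have h5 := Finset.sum_inter_add_sum_sdiff s (Finset.range k) w
  have h6 := Finset.sum_inter_add_sum_sdiff (Finset.range k) s w
  rw [Finset.inter_comm] at h6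
  linarith

/-- Summation by parts: domination of partial sums passes to decreasing weights. The slack `c`
carries the induction, becoming `c + b 0 - a ≥ 0` after the head is removed. -/
theorem geomSum_le_of_sum_take_le : ∀ (l : List ℝ) (b : ℕ → ℝ) (c : ℝ),
    (∀ n, 0 ≤ b n) → (∀ k, (l.take k).sum ≤ c + ∑ n ∈ Finset.range k, b n) →
    geomSum l ≤ c + ∑ n ∈ Finset.range l.length, b n / 2 ^ n
  | [], b, c, _, h => by simpa [geomSum] using h 0
  | a :: l, b, c, hb, h => by
    have h1 := h 1
    simp only [List.take_succ_cons, List.take_zero, List.sum_cons, List.sum_nil,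
      Finset.sum_range_one] at h1
    have ih := geomSum_le_of_sum_take_le l (fun n => b (n + 1)) (c + b 0 - a)
      (fun n => hb _) (fun k => by
        have := h (k + 1)
        rw [List.take_succ_cons, List.sum_cons, Finset.sum_range_succ'] at this
        linarith)
    simp only [geomSum, List.length_cons]
    rw [Finset.sum_range_succ']
    have : ∑ n ∈ Finset.range l.length, b (n + 1) / 2 ^ (n + 1) =
        (∑ n ∈ Finset.range l.length, b (n + 1) / 2 ^ n) / 2 := by
      rw [Finset.sum_div]
      exact Finset.sum_congr rfl fun n _ => by rw [pow_succ]; field_simp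
    rw [this]
    simp only [pow_zero, div_one]
    linarith

/-- Listing weights in non-increasing order maximizes the geometrically discounted sum. -/
theorem geomSum_map_le_tsum {w : ℕ → ℝ} (hw : Antitone w) (h0 : ∀ n, 0 ≤ w n) {s : List ℕ}
    (hs : s.Nodup) : geomSum (s.map w) ≤ ∑' n, w n / 2 ^ n := by
  have hsum : Summable fun n => w n / 2 ^ n := by
    refine Summable.of_nonneg_of_le (fun n => div_nonneg (h0 n) (by positivity)) (fun n => ?_)
      (summable_geometric_two' (2 * w 0))
    rw [mul_div_cancel_left₀ _ two_ne_zero]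
    gcongr
    exact hw n.zero_le
  have h := geomSum_le_of_sum_take_le (s.map w) w 0 h0 fun k => by
    have h1 : ((s.map w).take k).sum = ∑ n ∈ (s.take k).toFinset, w n := by
      rw [← List.map_take, List.sum_toFinset _ (hs.sublist (List.take_sublist k s))]
    rw [h1, zero_add]
    exact sum_le_sum_range_of_antitone hw h0
      ((List.toFinset_card_le _).trans (List.length_take_le k s))
  rw [zero_add] at h
  exact h.trans (hsum.sum_le_tsum _ fun n _ => div_nonneg (h0 n) (by positivity))

theorem geomSum_map_mul {ι : Type*} (c : ℝ) (w : ι → ℝ) (s : List ι) :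
    geomSum (s.map fun i => c * w i) = c * geomSum (s.map w) := by
  induction s with
  | nil => simp [geomSum]
  | cons i s ih =>
    simp only [List.map_cons, geomSum, ih]
    ring

theorem geomSum_map_range (w : ℕ → ℝ) (N : ℕ) :
    geomSum ((List.range N).map w) = ∑ n ∈ Finset.range N, w n / 2 ^ n := by
  induction N with
  | zero => simp [geomSum]
  | succ N ih =>
    rw [List.range_succ, List.map_append, List.map_singleton, geomSum_append_singleton, ih,
      Finset.sum_range_succ, List.length_map, List.length_range]

end Enumeration

/-! ### From strips in the plane to bands of a real function -/

section Geometry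

/-- The signed coordinate of the projection onto `normalLine t`. -/
def height (t : ℝ) (z : ℂ) : ℝ := Real.cos (π * t) * z.im - Real.sin (π * t) * z.re

theorem exp_mul_pi_mul_I (t : ℝ) :
    Complex.exp (t * π * Complex.I) =
      (Real.cos (π * t) : ℂ) + (Real.sin (π * t) : ℂ) * Complex.I := by
  rw [Complex.exp_mul_I]
  push_cast
  rw [mul_comm (π : ℂ)]

theorem exp_add_half_mul_pi_mul_I (t : ℝ) :
    Complex.exp ((t + 1 / 2) * π * Complex.I) =
      Complex.I * ((Real.cos (π * t) : ℂ) + (Real.sin (π * t) : ℂ) * Complex.I) := by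
  have : ((t : ℂ) + 1 / 2) * π * Complex.I = π / 2 * Complex.I + t * π * Complex.I := by ring
  rw [this, Complex.exp_add, Complex.exp_pi_div_two_mul_I, exp_mul_pi_mul_I]

theorem norm_exp_add_half_mul_pi_mul_I (t : ℝ) :
    ‖Complex.exp ((t + 1 / 2) * π * Complex.I)‖ = 1 := by
  have := Complex.norm_exp_ofReal_mul_I ((t + 1 / 2) * π)
  push_cast at this
  exact this

theorem projPerp_eq (t : ℝ) (z : ℂ) :
    projPerp t z = height t z • Complex.exp ((t + 1 / 2) * π * Complex.I) := by
  unfold projPerp normalLine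
  rw [Submodule.starProjection_unit_singleton ℝ (norm_exp_add_half_mul_pi_mul_I t)]
  congr 1
  rw [exp_add_half_mul_pi_mul_I, Complex.inner]
  simp [height, -Complex.ofReal_cos, -Complex.ofReal_sin]
  ring

theorem width_eq_diam_height (t : ℝ) (A : Set ℂ) : width t A = Metric.diam (height t '' A) := by
  have h : Isometry fun a : ℝ => a • Complex.exp ((t + 1 / 2) * π * Complex.I) :=
    Isometry.of_dist_eq fun a b => by
      rw [dist_eq_norm, ← sub_smul, norm_smul, norm_exp_add_half_mul_pi_mul_I, mul_one,
        dist_eq_norm]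
  rw [width, ← h.diam_image, image_image]
  exact congrArg _ (image_congr fun z _ => projPerp_eq t z)

theorem mem_strip_iff {x t μ : ℝ} (hμ : μ ≠ 0) (j : ℤ) (z : ℂ) :
    z ∈ strip x t μ j ↔ μ⁻¹ * height t z - x - j ∈ Icc (0 : ℝ) 1 := by
  have hcs := Real.cos_sq_add_sin_sq (π * t)
  unfold strip baseStrip
  constructor
  · rintro ⟨w, hw, rfl⟩
    have : μ⁻¹ * height t ((μ : ℂ) * Complex.exp (t * π * Complex.I) * (w + Complex.I * x)) =
        w.im + x := by
      rw [exp_mul_pi_mul_I]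
      simp [height, -Complex.ofReal_cos, -Complex.ofReal_sin]
      field_simp
      linear_combination (w.im + x) * hcs
    rw [mem_ofPred_eq] at hw
    rw [this]
    constructor <;> linarith [hw.1, hw.2]
  · intro h
    have hE : Complex.exp (t * π * Complex.I) ≠ 0 := Complex.exp_ne_zero _
    have hμ' : (μ : ℂ) ≠ 0 := by exact_mod_cast hμ
    refine ⟨((μ : ℂ))⁻¹ * Complex.exp (-(t * π * Complex.I)) * z - Complex.I * x, ?_, ?_⟩
    · have : (((μ : ℂ))⁻¹ * Complex.exp (-(t * π * Complex.I)) * z - Complex.I * x).im =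
          μ⁻¹ * height t z - x := by
        have h2 : -((t : ℂ) * π * Complex.I) = ((-t : ℝ) : ℂ) * π * Complex.I := by
          push_cast; ring
        rw [h2, exp_mul_pi_mul_I, ← Complex.ofReal_inv]
        simp [height, -Complex.ofReal_cos, -Complex.ofReal_sin]
        ring
      rw [mem_ofPred_eq, this]
      constructor <;> linarith [h.1, h.2]
    · rw [Complex.exp_neg]
      field_simp
      ring

variable {X : Type*} [TopologicalSpace X]

/-- The function `p ↦ height t (γ p)`. -/
def heightMap (γ : C(X, ℂ)) (t : ℝ) : C(X, ℝ) :=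
  Real.cos (π * t) • (⟨Complex.im, Complex.continuous_im⟩ : C(ℂ, ℝ)).comp γ -
    Real.sin (π * t) • (⟨Complex.re, Complex.continuous_re⟩ : C(ℂ, ℝ)).comp γ

@[simp] theorem heightMap_apply (γ : C(X, ℂ)) (t : ℝ) (p : X) :
    heightMap γ t p = height t (γ p) := rfl

/-- The function whose bands `[j, j + 1]` are the preimages of the strips under `γ`, with `l` the
inverse of the scale. -/
def levelMap (h : C(X, ℝ)) (x l : ℝ) : C(X, ℝ) := l • h - ContinuousMap.const X x

@[simp] theorem levelMap_apply (h : C(X, ℝ)) (x l : ℝ) (p : X) :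
    levelMap h x l p = l * h p - x := rfl

theorem preimage_strip (γ : C(X, ℂ)) {x t μ : ℝ} (hμ : μ ≠ 0) (j : ℤ) :
    γ ⁻¹' strip x t μ j = shift (levelMap (heightMap γ t) x μ⁻¹) j ⁻¹' Icc 0 1 := by
  ext p
  rw [mem_preimage, mem_strip_iff hμ]
  rfl

theorem width_image_eq (γ : C(X, ℂ)) {x t μ : ℝ} (hμ : 0 < μ) (j : ℤ) (C : Set X) :
    width t (γ '' C) =
      μ * Metric.diam (shift (levelMap (heightMap γ t) x μ⁻¹) j '' C) := by
  have hsm := diam_smul₀ μ (shift (levelMap (heightMap γ t) x μ⁻¹) j '' C)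
  rw [Real.norm_of_nonneg hμ.le] at hsm
  rw [width_eq_diam_height, ← hsm, ← (IsometryEquiv.addRight (-(μ * (x + j)))).isometry.diam_image,
    ← image_smul, image_image, image_image, image_image]
  refine congrArg _ (image_congr fun p _ => ?_)
  simp only [shift_apply, levelMap_apply, heightMap_apply, IsometryEquiv.addRight_apply,
    smul_eq_mul]
  field_simp
  ring

theorem mem_stripComponents_iff (γ : C(X, ℂ)) {x t μ : ℝ} (hμ : 0 < μ) (C : Set X) :
    C ∈ stripComponents γ x t μ ↔ ∃ (j : ℤ) (p : X),
      C = bandComp (shift (levelMap (heightMap γ t) x μ⁻¹) j) p ∧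
        0 < bandWidth (shift (levelMap (heightMap γ t) x μ⁻¹) j) p := by
  have hw : ∀ (j : ℤ) (p : X),
      (projPerp t '' (γ '' bandComp (shift (levelMap (heightMap γ t) x μ⁻¹) j) p)).Nontrivial ↔
        0 < bandWidth (shift (levelMap (heightMap γ t) x μ⁻¹) j) p := by
    intro j p
    set F := shift (levelMap (heightMap γ t) x μ⁻¹) j with hF
    have h1 : (projPerp t '' (γ '' bandComp F p)).Nontrivial ↔
        (F '' bandComp F p).Nontrivial := by
      have hinj : ∀ a b : X, projPerp t (γ a) = projPerp t (γ b) ↔ F a = F b := by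
        intro a b
        have hE : Complex.exp ((t + 1 / 2) * π * Complex.I) ≠ 0 := Complex.exp_ne_zero _
        rw [projPerp_eq, projPerp_eq, smul_left_inj hE, hF]
        simp [hμ.ne']
      rw [image_image]
      constructor
      · rintro ⟨_, ⟨a, ha, rfl⟩, _, ⟨b, hb, rfl⟩, hab⟩
        exact ⟨_, ⟨a, ha, rfl⟩, _, ⟨b, hb, rfl⟩, fun h => hab ((hinj a b).mpr h)⟩
      · rintro ⟨_, ⟨a, ha, rfl⟩, _, ⟨b, hb, rfl⟩, hab⟩
        exact ⟨_, ⟨a, ha, rfl⟩, _, ⟨b, hb, rfl⟩, fun h => hab ((hinj a b).mp h)⟩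
    rw [h1]
    constructor
    · exact fun h => Metric.diam_pos h (isBounded_image_bandComp F p)
    · intro h
      by_contra hn
      rw [bandWidth, Metric.diam_subsingleton (not_nontrivial_iff.mp hn)] at h
      exact lt_irrefl _ h
  constructor
  · rintro ⟨⟨j, p, hp, rfl⟩, hnt⟩
    rw [preimage_strip γ hμ.ne'] at hnt ⊢
    exact ⟨j, p, rfl, (hw j p).mp hnt⟩
  · rintro ⟨j, p, rfl, hpos⟩
    refine ⟨⟨j, p, ?_, ?_⟩, (hw j p).mpr hpos⟩
    · rw [preimage_strip γ hμ.ne']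
      exact connectedComponentIn_subset _ _ (mem_bandComp_self_of_bandWidth_pos hpos)
    · rw [preimage_strip γ hμ.ne']
      rfl

variable [CompactSpace X] [LocallyConnectedSpace X]

theorem exists_isOrderedEnumeration [TopologicalSpace.SeparableSpace X] [Nonempty X] (γ : C(X, ℂ))
    (x t : ℝ) {μ : ℝ} (hμ : 0 < μ) : ∃ C : ℕ → Set X, IsOrderedEnumeration γ x t μ C := by
  set f := levelMap (heightMap γ t) x μ⁻¹
  obtain ⟨e, h1, h2, h3, h4⟩ := exists_antitone_enumeration (S := stripComponents γ x t μ)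
    (v := fun C => width t (γ '' C)) (o := ∅) (fun C => Metric.diam_nonneg)
    (fun C hC => by
      obtain ⟨j, p, rfl, hpos⟩ := (mem_stripComponents_iff γ hμ C).mp hC
      rw [width_image_eq γ (x := x) hμ j]
      exact mul_pos hμ hpos)
    (by simp [width_empty])
    (fun ε hε => by
      obtain ⟨T, hT⟩ := exists_finset_representatives
        (TopologicalSpace.denseRange_denseSeq X) f (div_pos hε hμ)
      refine ((T.finite_toSet).image (indexComp (TopologicalSpace.denseSeq X) f)).subset ?_
      rintro C ⟨hC, hεC⟩
      obtain ⟨j, p, rfl, hpos⟩ := (mem_stripComponents_iff γ hμ C).mp hC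
      rw [width_image_eq γ (x := x) hμ j] at hεC
      obtain ⟨i, hi, rfl, he, -⟩ := hT.self_of_nhds j p (by
        rw [div_le_iff₀' hμ]
        exact hεC)
      exact ⟨i, hi, he⟩)
  exact ⟨e, h1, h2, h3, h4⟩

/-- Partial sums of the enumeration come from admissible lists, which gives `≤`. Conversely an
admissible list occupies distinct positions of the enumeration, and the decreasing order is the best
one. -/
theorem IsOrderedEnumeration.tsum_eq {u : ℕ → X} (hu : DenseRange u) (γ : C(X, ℂ)) {x t μ : ℝ}
    (hμ : 0 < μ) {C : ℕ → Set X} (hC : IsOrderedEnumeration γ x t μ C) :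
    ∑' n, width t (γ '' C n) / 2 ^ n = μ * bandSum u (levelMap (heightMap γ t) x μ⁻¹) := by
  set f := levelMap (heightMap γ t) x μ⁻¹ with hf
  have hanti : Antitone fun n => width t (γ '' C n) := antitone_nat_of_succ_le hC.ordered
  have hnn : ∀ n, 0 ≤ width t (γ '' C n) := fun n => Metric.diam_nonneg
  have hwpos : ∀ D ∈ stripComponents γ x t μ, 0 < width t (γ '' D) := by
    intro D hD
    obtain ⟨j, p, rfl, hpos⟩ := (mem_stripComponents_iff γ hμ D).mp hD
    rw [width_image_eq γ (x := x) hμ j]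
    exact mul_pos hμ hpos
  have hwi : ∀ i, width t (γ '' indexComp u f i) = μ * indexWidth u f i := fun i =>
    width_image_eq γ (x := x) hμ i.2 _
  refine le_antisymm ?_ ?_
  · refine Real.tsum_le_of_sum_range_le (fun n => div_nonneg (hnn n) (by positivity)) fun N => ?_
    -- Widths are non-increasing and positive on genuine components, so the empty padding only comes
    -- after them.
    obtain ⟨M, hM, hsum⟩ : ∃ M, (∀ n < M, C n ∈ stripComponents γ x t μ) ∧
        ∑ n ∈ Finset.range N, width t (γ '' C n) / 2 ^ n =
          ∑ n ∈ Finset.range M, width t (γ '' C n) / 2 ^ n := by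
      induction N with
      | zero => exact ⟨0, by simp, rfl⟩
      | succ N ih =>
        by_cases hN : C N ∈ stripComponents γ x t μ
        · refine ⟨N + 1, fun n hn => ?_, rfl⟩
          refine (hC.mem_or_empty n).resolve_right fun h => ?_
          have h1 : width t (γ '' C N) ≤ width t (γ '' C n) := hanti (Nat.le_of_lt_succ hn)
          rw [h, image_empty, width_empty] at h1
          exact absurd (hwpos _ hN) (not_lt.mpr h1)
        · obtain ⟨M, hM, hsum⟩ := ih
          refine ⟨M, hM, ?_⟩
          rw [Finset.sum_range_succ, hsum, (hC.mem_or_empty N).resolve_left hN, image_empty,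
            width_empty, zero_div, add_zero]
    have hidx : ∀ n, n < M → ∃ i, indexComp u f i = C n := by
      intro n hn
      obtain ⟨j, p, hp, hpos⟩ := (mem_stripComponents_iff γ hμ _).mp (hM n hn)
      obtain ⟨T, hT⟩ := exists_finset_representatives hu f hpos
      obtain ⟨i, -, rfl, he, -⟩ := hT.self_of_nhds j p le_rfl
      exact ⟨i, he.trans hp.symm⟩
    choose! idx hidx using hidx
    have hwidx : ∀ n < M, width t (γ '' C n) = μ * indexWidth u f (idx n) := fun n hn => by
      rw [← hidx n hn, hwi]
    have hadm : Admissible u f ((List.range M).map idx) := by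
      have hpos : ∀ n < M, 0 < indexWidth u f (idx n) := fun n hn => by
        have := hwpos _ (hM n hn)
        rw [hwidx n hn] at this
        exact pos_of_mul_pos_right this hμ.le
      refine ⟨fun i hi => ?_, ?_⟩
      · obtain ⟨n, hn, rfl⟩ := List.mem_map.mp hi
        exact hpos n (List.mem_range.mp hn)
      · rw [List.pairwise_map]
        refine (List.nodup_range (n := M)).imp_of_mem fun {m n} hm hn hmn h2 hmem => hmn ?_
        rw [List.mem_range] at hm hn
        refine hC.no_repetition m n (hM m hm) ?_
        rw [← hidx m hm, ← hidx n hn]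
        have := bandComp_eq_of_mem hmem
        rw [h2] at this
        unfold indexComp
        rw [this, h2]
    rw [hsum]
    calc ∑ n ∈ Finset.range M, width t (γ '' C n) / 2 ^ n
        = μ * geomSum (((List.range M).map idx).map (indexWidth u f)) := by
          rw [List.map_map, geomSum_map_range, Finset.mul_sum]
          refine Finset.sum_congr rfl fun n hn => ?_
          rw [hwidx n (Finset.mem_range.mp hn), mul_div_assoc]
          rfl
      _ ≤ μ * bandSum u f := by gcongr; exact le_bandSum hadm
  · rw [← le_div_iff₀' hμ]
    refine bandSum_le (div_nonneg (tsum_nonneg fun n => div_nonneg (hnn n) (by positivity)) hμ.le)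
      fun s hs => ?_
    rw [le_div_iff₀' hμ, ← geomSum_map_mul]
    have hself : ∀ i ∈ s, u i.1 ∈ indexComp u f i := fun i hi =>
      mem_bandComp_self_of_bandWidth_pos (hs.1 i hi)
    have hposn : ∀ i, i ∈ s → ∃ n, C n = indexComp u f i := fun i hi =>
      hC.exhausts _ ((mem_stripComponents_iff γ hμ _).mpr ⟨i.2, u i.1, rfl, hs.1 i hi⟩)
    choose! pos hposn using hposn
    have hnodup : (s.map pos).Nodup := by
      refine List.pairwise_map.mpr (hs.2.imp_of_mem fun {i k} hi hk h hik => ?_)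
      have hcomp : indexComp u f i = indexComp u f k := by
        rw [← hposn i hi, ← hposn k hk, hik]
      by_cases h2 : i.2 = k.2
      · exact h h2 (hcomp ▸ hself k hk)
      -- Two different bands meet in at most one level, so a common component would have width zero.
      · have hconst : (shift f i.2 '' indexComp u f i).Subsingleton := by
          have hval : ∀ p ∈ indexComp u f i, f p = max (i.2 : ℝ) k.2 := by
            intro p hp
            have h3 := connectedComponentIn_subset _ _ hp
            have h4 := connectedComponentIn_subset _ _ (hcomp ▸ hp : p ∈ indexComp u f k)
            simp only [mem_preimage, shift_apply, mem_Icc] at h3 h4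
            rcases lt_or_gt_of_ne h2 with hlt | hlt
            · have h5 : (i.2 : ℝ) + 1 ≤ k.2 := by exact_mod_cast hlt
              rw [max_eq_right (by linarith)]
              linarith [h3.2, h4.1]
            · have h5 : (k.2 : ℝ) + 1 ≤ i.2 := by exact_mod_cast hlt
              rw [max_eq_left (by linarith)]
              linarith [h4.2, h3.1]
          rintro _ ⟨p, hp, rfl⟩ _ ⟨q, hq, rfl⟩
          rw [shift_apply, shift_apply, hval p hp, hval q hq]
        exact absurd (hs.1 i hi) (not_lt.mpr (Metric.diam_subsingleton hconst).le)
    have hmap : s.map (fun i => μ * indexWidth u f i) =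
        (s.map pos).map fun n => width t (γ '' C n) := by
      rw [List.map_map]
      refine List.map_congr_left fun i hi => ?_
      simp only [Function.comp_apply]
      rw [hposn i hi, hwi]
    rw [hmap]
    exact geomSum_map_le_tsum hanti hnn hnodup

theorem stripSum_eq [TopologicalSpace.SeparableSpace X] [Nonempty X] {u : ℕ → X}
    (hu : DenseRange u) (γ : C(X, ℂ)) (x t : ℝ) {μ : ℝ} (hμ : 0 < μ) :
    stripSum γ x t μ = μ * bandSum u (levelMap (heightMap γ t) x μ⁻¹) := by
  have h := exists_isOrderedEnumeration γ x t hμ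
  rw [stripSum, dif_pos h]
  exact h.choose_spec.tsum_eq hu γ hμ

end Geometry

/-! ### Regularity for almost all parameters -/

section Regularity

variable {X : Type*} [TopologicalSpace X]

theorem isRegular_iff (u : ℕ → X) (f : C(X, ℝ)) : IsRegular u f ↔ ∀ (i : ℕ × ℤ) (n : ℕ),
    ¬ (u n ∈ indexComp u f i ∧ ∀ k : ℕ, u n ∉ connectedComponentIn
      (shift f i.2 ⁻¹' Icc (1 / (k + 1 : ℝ)) (1 - 1 / (k + 1 : ℝ))) (u i.1)) := by
  unfold IsRegular
  push Not
  rfl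

theorem measurableSet_regularity_fails [CompactSpace X] [T2Space X] {Θ : Type*}
    [TopologicalSpace Θ] [MeasurableSpace Θ] [OpensMeasurableSpace Θ] (u : ℕ → X)
    {Φ : Θ → C(X, ℝ)} (hΦ : Continuous Φ) (i : ℕ × ℤ) (n : ℕ) :
    MeasurableSet {θ | u n ∈ indexComp u (Φ θ) i ∧ ∀ k : ℕ, u n ∉ connectedComponentIn
      (shift (Φ θ) i.2 ⁻¹' Icc (1 / (k + 1 : ℝ)) (1 - 1 / (k + 1 : ℝ))) (u i.1)} := by
  have h1 : MeasurableSet {θ | u n ∈ indexComp u (Φ θ) i} :=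
    ((isClosed_setOf_mem_indexComp u i (u n)).preimage hΦ).measurableSet
  have h2 : ∀ k : ℕ, MeasurableSet {θ | u n ∉ connectedComponentIn
      (shift (Φ θ) i.2 ⁻¹' Icc (1 / (k + 1 : ℝ)) (1 - 1 / (k + 1 : ℝ))) (u i.1)} := fun k =>
    ((isClosed_setOf_mem_connectedComponentIn_preimage (u i.1) (u n) isClosed_Icc).preimage
      ((continuous_shift i.2).comp hΦ)).measurableSet.compl
  have h3 := h1.inter (MeasurableSet.iInter h2)
  convert h3 using 1
  ext θ
  simp

theorem measurableSet_isRegular [CompactSpace X] [T2Space X] {Θ : Type*}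
    [TopologicalSpace Θ] [MeasurableSpace Θ] [OpensMeasurableSpace Θ] (u : ℕ → X)
    {Φ : Θ → C(X, ℝ)} (hΦ : Continuous Φ) : MeasurableSet {θ | IsRegular u (Φ θ)} := by
  simp only [isRegular_iff, ofPred_forall]
  exact MeasurableSet.iInter fun i => MeasurableSet.iInter fun n =>
    (measurableSet_regularity_fails u hΦ i n).compl

/-- For bands centered at a fixed height, regularity fails at one width only. -/
theorem subsingleton_regularity_fails (u : ℕ → X) (h : C(X, ℝ)) (σ : ℝ) (i : ℕ × ℤ) (n : ℕ) :
    {μ : ℝ | 0 < μ ∧ u n ∈ indexComp u (levelMap h (μ⁻¹ * σ - i.2 - 1 / 2) μ⁻¹) i ∧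
      ∀ k : ℕ, u n ∉ connectedComponentIn
        (shift (levelMap h (μ⁻¹ * σ - i.2 - 1 / 2) μ⁻¹) i.2 ⁻¹'
          Icc (1 / (k + 1 : ℝ)) (1 - 1 / (k + 1 : ℝ))) (u i.1)}.Subsingleton := by
  have key : ∀ μ₁ μ₂ : ℝ, 0 < μ₁ → μ₁ < μ₂ →
      u n ∈ indexComp u (levelMap h (μ₁⁻¹ * σ - i.2 - 1 / 2) μ₁⁻¹) i →
      ∃ k : ℕ, u n ∈ connectedComponentIn
        (shift (levelMap h (μ₂⁻¹ * σ - i.2 - 1 / 2) μ₂⁻¹) i.2 ⁻¹'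
          Icc (1 / (k + 1 : ℝ)) (1 - 1 / (k + 1 : ℝ))) (u i.1) := by
    intro μ₁ μ₂ h1 h12 hn
    have h2 : 0 < μ₂ := h1.trans h12
    have hr : μ₁ / μ₂ < 1 := (div_lt_one h2).mpr h12
    -- In units of `μ₂` the smaller band is `[(1 - r) / 2, (1 + r) / 2]` with `r = μ₁ / μ₂`.
    obtain ⟨k, hk⟩ := exists_nat_one_div_lt (show 0 < (1 - μ₁ / μ₂) / 2 by linarith)
    refine ⟨k, connectedComponentIn_mono _ ?_ hn⟩
    intro p hp
    simp only [mem_preimage, shift_apply, levelMap_apply, mem_Icc] at hp ⊢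
    have e1 : μ₁⁻¹ * h p - (μ₁⁻¹ * σ - i.2 - 1 / 2) - i.2 = μ₁⁻¹ * (h p - σ) + 1 / 2 := by ring
    have e2 : μ₂⁻¹ * h p - (μ₂⁻¹ * σ - i.2 - 1 / 2) - i.2 =
        μ₁ / μ₂ * (μ₁⁻¹ * (h p - σ)) + 1 / 2 := by
      field_simp
      ring
    rw [e1] at hp
    rw [e2]
    have hr0 : 0 < μ₁ / μ₂ := div_pos h1 h2
    have h3 : μ₁ / μ₂ * (μ₁⁻¹ * (h p - σ)) ≤ μ₁ / μ₂ * (1 / 2) :=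
      mul_le_mul_of_nonneg_left (by linarith [hp.2]) hr0.le
    have h4 : μ₁ / μ₂ * (-(1 / 2)) ≤ μ₁ / μ₂ * (μ₁⁻¹ * (h p - σ)) :=
      mul_le_mul_of_nonneg_left (by linarith [hp.1]) hr0.le
    constructor <;> linarith
  rintro μ₁ ⟨h1, h1n, h1k⟩ μ₂ ⟨h2, h2n, h2k⟩
  rcases lt_trichotomy μ₁ μ₂ with hlt | heq | hgt
  · obtain ⟨k, hk⟩ := key μ₁ μ₂ h1 hlt h1n
    exact absurd hk (h2k k)
  · exact heq
  · obtain ⟨k, hk⟩ := key μ₂ μ₁ h2 hgt h2n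
    exact absurd hk (h1k k)

theorem continuous_levelMap {Θ : Type*} [TopologicalSpace Θ] {h : Θ → C(X, ℝ)} {x l : Θ → ℝ}
    (hh : Continuous h) (hx : Continuous x) (hl : Continuous l) :
    Continuous fun θ => levelMap (h θ) (x θ) (l θ) :=
  (hl.smul hh).sub (ContinuousMap.continuous_const'.comp hx)

/-- Use the center `σ = μ * (x + j + 1 / 2)` of the band in place of `x`. For fixed `σ` at most one
`μ` is bad; Fubini exchanges the two, and for fixed `μ` the affine map from `x` to `σ` respects null
sets. There are countably many index pairs. -/
theorem ae_isRegular [CompactSpace X] [T2Space X] (u : ℕ → X) (h : C(X, ℝ)) :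
    ∀ᵐ μ : ℝ, 0 < μ → ∀ᵐ x : ℝ, IsRegular u (levelMap h x μ⁻¹) := by
  have hin : ∀ (i : ℕ × ℤ) (n : ℕ), ∀ᵐ μ : ℝ, 0 < μ → ∀ᵐ x : ℝ,
      ¬ (u n ∈ indexComp u (levelMap h x μ⁻¹) i ∧ ∀ k : ℕ, u n ∉ connectedComponentIn
        (shift (levelMap h x μ⁻¹) i.2 ⁻¹' Icc (1 / (k + 1 : ℝ)) (1 - 1 / (k + 1 : ℝ)))
          (u i.1)) := by
    intro i n
    -- Here `θ.2` is the inverse scale: inversion is discontinuous at `0`, so it is inserted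
    -- afterwards as a measurable map.
    have hΦ : Continuous fun θ : ℝ × ℝ => levelMap h (θ.2 * θ.1 - i.2 - 1 / 2) θ.2 :=
      continuous_levelMap continuous_const (by fun_prop) (by fun_prop)
    have hmeas : MeasurableSet {θ : ℝ × ℝ | ¬ (0 < θ.2 ∧
        u n ∈ indexComp u (levelMap h (θ.2⁻¹ * θ.1 - i.2 - 1 / 2) θ.2⁻¹) i ∧
        ∀ k : ℕ, u n ∉ connectedComponentIn
          (shift (levelMap h (θ.2⁻¹ * θ.1 - i.2 - 1 / 2) θ.2⁻¹) i.2 ⁻¹'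
            Icc (1 / (k + 1 : ℝ)) (1 - 1 / (k + 1 : ℝ))) (u i.1))} :=
      ((measurableSet_lt measurable_const measurable_snd).inter
        ((measurableSet_regularity_fails u hΦ i n).preimage
          (measurable_fst.prodMk measurable_snd.inv))).compl
    have hae : ∀ᵐ σ : ℝ, ∀ᵐ μ : ℝ, ¬ (0 < μ ∧
        u n ∈ indexComp u (levelMap h (μ⁻¹ * σ - i.2 - 1 / 2) μ⁻¹) i ∧
        ∀ k : ℕ, u n ∉ connectedComponentIn
          (shift (levelMap h (μ⁻¹ * σ - i.2 - 1 / 2) μ⁻¹) i.2 ⁻¹'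
            Icc (1 / (k + 1 : ℝ)) (1 - 1 / (k + 1 : ℝ))) (u i.1)) :=
      Eventually.of_forall fun σ =>
        measure_eq_zero_iff_ae_notMem.mp
          ((subsingleton_regularity_fails u h σ i n).measure_zero volume)
    rw [Measure.ae_ae_comm hmeas] at hae
    filter_upwards [hae] with μ hμ hpos
    have hq : ∀ᵐ x : ℝ, ¬ (0 < μ ∧
        u n ∈ indexComp u (levelMap h (μ⁻¹ * (μ * (x + (i.2 + 1 / 2))) - i.2 - 1 / 2) μ⁻¹) i ∧
        ∀ k : ℕ, u n ∉ connectedComponentIn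
          (shift (levelMap h (μ⁻¹ * (μ * (x + (i.2 + 1 / 2))) - i.2 - 1 / 2) μ⁻¹) i.2 ⁻¹'
            Icc (1 / (k + 1 : ℝ)) (1 - 1 / (k + 1 : ℝ))) (u i.1)) := by
      have h1 : Measure.QuasiMeasurePreserving (fun x : ℝ => μ * x) volume volume := by
        refine ⟨by fun_prop, fun s hs => ?_⟩
        rw [Real.map_volume_mul_left hpos.ne']
        simp [hs]
      exact (h1.comp (measurePreserving_add_right volume
        ((i.2 : ℝ) + 1 / 2)).quasiMeasurePreserving).ae hμ
    filter_upwards [hq] with x hx hbad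
    refine hx ⟨hpos, ?_⟩
    have : μ⁻¹ * (μ * (x + (i.2 + 1 / 2))) - i.2 - 1 / 2 = x := by
      rw [inv_mul_cancel_left₀ hpos.ne']; ring
    rw [this]
    exact hbad
  have hall : ∀ᵐ μ : ℝ, ∀ (i : ℕ × ℤ) (n : ℕ), _ :=
    ae_all_iff.mpr fun i => ae_all_iff.mpr fun n => hin i n
  filter_upwards [hall] with μ hμ hpos
  have h2 : ∀ᵐ x : ℝ, ∀ (i : ℕ × ℤ) (n : ℕ), _ :=
    ae_all_iff.mpr fun i => ae_all_iff.mpr fun n => hμ i n hpos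
  filter_upwards [h2] with x hx
  exact (isRegular_iff u _).mpr hx

end Regularity

/-! ### Fubini and dominated convergence -/

section Integral

variable {X : Type*} [TopologicalSpace X]

theorem continuous_heightMap_param (γ : C(X, ℂ)) : Continuous (heightMap γ) := by
  unfold heightMap
  fun_prop

theorem continuous_heightMap (t : ℝ) : Continuous fun γ : C(X, ℂ) => heightMap γ t := by
  have h1 : Continuous fun γ : C(X, ℂ) => (⟨Complex.im, Complex.continuous_im⟩ : C(ℂ, ℝ)).comp γ :=
    ContinuousMap.continuous_postcomp _
  have h2 : Continuous fun γ : C(X, ℂ) => (⟨Complex.re, Complex.continuous_re⟩ : C(ℂ, ℝ)).comp γ :=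
    ContinuousMap.continuous_postcomp _
  exact (h1.const_smul (Real.cos (π * t))).sub (h2.const_smul (Real.sin (π * t)))

/-- The scaled `bandSum`, as a function of the parameters `(μ, t, x)`. -/
def scaledBandSum (u : ℕ → X) (γ : C(X, ℂ)) (p : ℝ × ℝ × ℝ) : ℝ :=
  p.1 * bandSum u (levelMap (heightMap γ p.2.1) p.2.2 p.1⁻¹)

theorem continuous_levelMap_heightMap (γ : C(X, ℂ)) :
    Continuous fun p : ℝ × ℝ × ℝ => levelMap (heightMap γ p.2.1) p.2.2 p.1 :=
  continuous_levelMap ((continuous_heightMap_param γ).comp (by fun_prop)) (by fun_prop)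
    (by fun_prop)

theorem measurable_scaledBandSum [CompactSpace X] [T2Space X] (u : ℕ → X) (γ : C(X, ℂ)) :
    Measurable (scaledBandSum u γ) := by
  have h1 := measurable_bandSum_comp u (continuous_levelMap_heightMap γ)
  have h2 : Measurable fun p : ℝ × ℝ × ℝ => (p.1⁻¹, p.2) := measurable_fst.inv.prodMk measurable_snd
  have h3 := h1.comp h2
  exact measurable_fst.mul h3

theorem norm_scaledBandSum_le (u : ℕ → X) (γ : C(X, ℂ)) {p : ℝ × ℝ × ℝ} (hp : p.1 ∈ Ioc (0 : ℝ) 1) :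
    ‖scaledBandSum u γ p‖ ≤ 2 := by
  have h0 := bandSum_nonneg u (levelMap (heightMap γ p.2.1) p.2.2 p.1⁻¹)
  have h2 := bandSum_le_two u (levelMap (heightMap γ p.2.1) p.2.2 p.1⁻¹)
  rw [scaledBandSum, Real.norm_of_nonneg (mul_nonneg hp.1.le h0)]
  nlinarith [hp.1, hp.2]

/-- Lebesgue measure on `(0, 1]`. -/
abbrev unitMeasure : Measure ℝ := volume.restrict (Ioc 0 1)

theorem ae_fst_mem_Ioc :
    ∀ᵐ p : ℝ × ℝ × ℝ ∂unitMeasure.prod (unitMeasure.prod unitMeasure), p.1 ∈ Ioc (0 : ℝ) 1 :=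
  Measure.quasiMeasurePreserving_fst.ae (ae_restrict_mem measurableSet_Ioc)

theorem integrable_scaledBandSum [CompactSpace X] [T2Space X] (u : ℕ → X) (γ : C(X, ℂ)) :
    Integrable (scaledBandSum u γ) (unitMeasure.prod (unitMeasure.prod unitMeasure)) :=
  Integrable.of_bound (measurable_scaledBandSum u γ).aestronglyMeasurable 2
    (ae_fst_mem_Ioc.mono fun _ hp => norm_scaledBandSum_le u γ hp)

theorem len_eq_integral [CompactSpace X] [T2Space X] [LocallyConnectedSpace X]
    [TopologicalSpace.SeparableSpace X] [Nonempty X] {u : ℕ → X} (hu : DenseRange u)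
    (γ : C(X, ℂ)) :
    len γ = ∫ p, scaledBandSum u γ p ∂unitMeasure.prod (unitMeasure.prod unitMeasure) := by
  have hint := integrable_scaledBandSum u γ
  rw [integral_prod _ hint, len, intervalIntegral.integral_of_le zero_le_one]
  refine integral_congr_ae ?_
  filter_upwards [hint.prod_right_ae, ae_restrict_mem measurableSet_Ioc] with μ hμ hμ1
  rw [integral_prod _ hμ, intervalIntegral.integral_of_le zero_le_one]
  refine integral_congr_ae (Eventually.of_forall fun t => ?_)
  dsimp only
  rw [intervalIntegral.integral_of_le zero_le_one]
  exact integral_congr_ae (Eventually.of_forall fun x => stripSum_eq hu γ x t hμ1.1)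

theorem lenWellDefined [CompactSpace X] [T2Space X] [LocallyConnectedSpace X]
    [TopologicalSpace.SeparableSpace X] [Nonempty X] (γ : C(X, ℂ)) : LenWellDefined γ := by
  refine ⟨fun x _ t _ μ hμ => exists_isOrderedEnumeration γ x t hμ.1, ?_⟩
  have hS : MeasurableSet (Icc (0 : ℝ) 1 ×ˢ Icc (0 : ℝ) 1 ×ˢ Ioc (0 : ℝ) 1) :=
    measurableSet_Icc.prod (measurableSet_Icc.prod measurableSet_Ioc)
  set u := TopologicalSpace.denseSeq X
  have hu : DenseRange u := TopologicalSpace.denseRange_denseSeq X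
  -- The parameters are ordered `(x, t, μ)` here, but `(μ, t, x)` in `scaledBandSum`.
  have hm : Measurable fun p : ℝ × ℝ × ℝ => scaledBandSum u γ (p.2.2, p.2.1, p.1) :=
    (measurable_scaledBandSum u γ).comp (by fun_prop)
  have hfin : volume (Icc (0 : ℝ) 1 ×ˢ Icc (0 : ℝ) 1 ×ˢ Ioc (0 : ℝ) 1) ≠ ⊤ := by
    have hc : IsCompact (Icc (0 : ℝ) 1 ×ˢ Icc (0 : ℝ) 1 ×ˢ Icc (0 : ℝ) 1) :=
      isCompact_Icc.prod (isCompact_Icc.prod isCompact_Icc)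
    exact ((measure_mono (prod_mono_right (prod_mono_right Ioc_subset_Icc_self))).trans_lt
      hc.measure_lt_top).ne
  have h : IntegrableOn (fun p : ℝ × ℝ × ℝ => scaledBandSum u γ (p.2.2, p.2.1, p.1))
      (Icc (0 : ℝ) 1 ×ˢ Icc (0 : ℝ) 1 ×ˢ Ioc (0 : ℝ) 1) := by
    refine Measure.integrableOn_of_bounded (M := 2) hfin hm.aestronglyMeasurable ?_
    filter_upwards [ae_restrict_mem hS] with p hp
    exact norm_scaledBandSum_le u γ hp.2.2
  refine h.congr_fun (fun p hp => ?_) hS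
  exact (stripSum_eq hu γ p.1 p.2.1 hp.2.2.1).symm

theorem ae_isRegular_levelMap [CompactSpace X] [T2Space X] (u : ℕ → X) (γ : C(X, ℂ)) :
    ∀ᵐ p : ℝ × ℝ × ℝ ∂unitMeasure.prod (unitMeasure.prod unitMeasure),
      IsRegular u (levelMap (heightMap γ p.2.1) p.2.2 p.1⁻¹) := by
  have hS : MeasurableSet {p : ℝ × ℝ × ℝ |
      IsRegular u (levelMap (heightMap γ p.2.1) p.2.2 p.1⁻¹)} := by
    have h1 := measurableSet_isRegular u (continuous_levelMap_heightMap γ)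
    have h2 : Measurable fun p : ℝ × ℝ × ℝ => (p.1⁻¹, p.2) :=
      measurable_fst.inv.prodMk measurable_snd
    exact h2 h1
  have hS' : MeasurableSet {q : (ℝ × ℝ) × ℝ |
      IsRegular u (levelMap (heightMap γ q.1.1) q.2 q.1.2⁻¹)} :=
    hS.preimage (f := fun q : (ℝ × ℝ) × ℝ => (q.1.2, q.1.1, q.2)) (by fun_prop)
  have hQ : MeasurableSet {q : ℝ × ℝ | ∀ᵐ x ∂unitMeasure,
      IsRegular u (levelMap (heightMap γ q.1) x q.2⁻¹)} :=
    measurable_measure_prodMk_left hS'.compl (measurableSet_singleton 0)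
  -- Regularity is known for each fixed `t`, so `t` is outermost first; the swap with `μ` then
  -- matches the order of integration.
  have hall : ∀ᵐ t ∂unitMeasure, ∀ᵐ μ ∂unitMeasure, ∀ᵐ x ∂unitMeasure,
      IsRegular u (levelMap (heightMap γ t) x μ⁻¹) := by
    refine Eventually.of_forall fun t => ?_
    filter_upwards [ae_restrict_of_ae (ae_isRegular u (heightMap γ t)),
      ae_restrict_mem measurableSet_Ioc] with μ hμ hpos
    exact ae_restrict_of_ae (hμ hpos.1)
  rw [Measure.ae_ae_comm hQ] at hall
  refine (Measure.ae_prod_mem_iff_ae_ae_mem hS).mpr ?_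
  filter_upwards [hall] with μ hμ
  exact (Measure.ae_prod_mem_iff_ae_ae_mem (hS.preimage measurable_prodMk_left)).mpr hμ

theorem tendsto_len [CompactSpace X] [T2Space X] [LocallyConnectedSpace X]
    [TopologicalSpace.SeparableSpace X] [Nonempty X] {γs : ℕ → C(X, ℂ)} {γ : C(X, ℂ)}
    (h : Tendsto γs atTop (𝓝 γ)) : Tendsto (fun m => len (γs m)) atTop (𝓝 (len γ)) := by
  have hu := TopologicalSpace.denseRange_denseSeq X
  simp only [len_eq_integral hu]
  refine tendsto_integral_of_dominated_convergence (fun _ => 2)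
    (fun m => (measurable_scaledBandSum _ _).aestronglyMeasurable) (integrable_const _)
    (fun m => ae_fst_mem_Ioc.mono fun _ hp => norm_scaledBandSum_le _ _ hp) ?_
  filter_upwards [ae_isRegular_levelMap (TopologicalSpace.denseSeq X) γ] with p hp
  have hc : Continuous fun δ : C(X, ℂ) => levelMap (heightMap δ p.2.1) p.2.2 p.1⁻¹ :=
    continuous_levelMap (continuous_heightMap _) continuous_const continuous_const
  exact ((hp.continuousAt_bandSum hu).tendsto.comp ((hc.tendsto γ).comp h)).const_mul p.1

end Integral

end

end StripLength

theorem proposition7 {X : Type*} [TopologicalSpace X] [TopologicalSpace.MetrizableSpace X]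
    [CompactSpace X] [ConnectedSpace X] [LocallyConnectedSpace X]
    (γs : ℕ → X → ℂ) (hγs : ∀ m, Continuous (γs m))
    (γ : X → ℂ) (hlim : TendstoUniformly γs γ atTop) :
    ((∀ m, StripLength.LenWellDefined (γs m)) ∧ StripLength.LenWellDefined γ) ∧
      Tendsto (fun m => StripLength.len (γs m)) atTop (𝓝 (StripLength.len γ)) := by
  let _ : MetricSpace X := TopologicalSpace.metrizableSpaceMetric X
  have hγ : Continuous γ := hlim.continuous (Eventually.of_forall hγs).frequently
  let g : C(X, ℂ) := ⟨γ, hγ⟩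
  let gs : ℕ → C(X, ℂ) := fun m => ⟨γs m, hγs m⟩
  have hg : Tendsto gs atTop (𝓝 g) := ContinuousMap.tendsto_iff_tendstoUniformly.mpr hlim
  exact ⟨⟨fun m => StripLength.lenWellDefined (gs m), StripLength.lenWellDefined g⟩,
    StripLength.tendsto_len hg⟩
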